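/- Let $\lambda$ be an infinite cardinal and let $\mathfrak{s}=(K,\preceq,S^{bs},\bot)$ be a semi-good $\lambda$-frame. That is: (0) $(K,\preceq)$ is an abstract elementary class with $\mathrm{LST}(K,\preceq)\le\lambda$. Write $K_\mu$ for the models in $K$ of cardinality $\mu$, and $S(M)$ for the set of Galois types $\mathrm{tp}(a,M,N)$ ($M\preceq N$, $a\in N$). (1) $K_\lambda$ has joint embedding, amalgamation and no $\preceq$-maximal model. (2) For each $M\in K_\lambda$, $S^{bs}(M)$ (the basic types) is a set of non-algebraic types over $M$ with $|S^{bs}(M)|\le\lambda^+$; it is invariant under isomorphisms; and if $M\prec N$ are in $K_\lambda$, some $a\in N\setminus M$ has $\mathrm{tp}(a,M,N)\in S^{bs}(M)$. (3) $\bot(M_0,M_1,a,M_3)$ is an isomorphism-invariant relation which implies $M_0\preceq M_1\preceq M_3$ in $K_\lambda$, $a\in M_3\setminus M_1$ and $\mathrm{tp}(a,M_n,M_3)\in S^{bs}(M_n)$ for $n=0,1$. Say that $p\in S(N)$ does not fork over $M$ if $p=\mathrm{tp}(a,N,N^+)$ and $\bot(M,N,a,N^+)$ for some $a,N^+$. With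 all models in $K_\lambda$: * Monotonicity: if $\bot(M_0,M_1,a,M_3)$, $M_0\preceq M_0^*\preceq M_1^*\preceq M_1$, $M_3\preceq M_3^*$ and $M_1^*\cup\{a\}\subseteq M_3^{**}\preceq M_3^*$, then $\bot(M_0^*,M_1^*,a,M_3^{**})$. * Local character: if $\delta<\lambda^+$ is a limit, $\langle M_\alpha:\alpha\le\delta+1\rangle$ is increasing continuous and $\mathrm{tp}(a,M_\delta,M_{\delta+1})$ is basic, then this type does not fork over $M_\alpha$ for some $\alpha<\delta$. * Uniqueness: if $M\preceq N$, $p,q\in S^{bs}(N)$ do not fork over $M$ and $p\restriction M=q\restriction M$, then $p=q$. * Symmetry: if $M_0\preceq M_1\preceq M_3$, $a_1\in M_1$, $\mathrm{tp}(a_1,M_0,M_3)$ is basic and $\mathrm{tp}(a_2,M_1,M_3)$ does not fork over $M_0$, then there are $M_2,M_3^*$ with $a_2\in M_2$, $M_0\preceq M_2\preceq M_3^*$, $M_3\preceq M_3^*$ such that $\mathrm{tp}(a_1,M_2,M_3^*)$ does not fork over $M_0$. * Extension: if $M\prec N$ and $p\in S^{bs}(M)$, some $q\in S^{bs}(N)$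 does not fork over $M$ and satisfies $q\restriction M=p$. * Continuity: if $\delta<\lambda^+$ is a limit, $\langle M_\alpha:\alpha\le\delta\rangle$ is increasing continuous, $p\in S(M_\delta)$ and $p\restriction M_\alpha$ does not fork over $M_0$ for all $\alpha<\delta$, then $p$ is basic and does not fork over $M_0$. Assume that $(K,\preceq)$ has the amalgamation property in $\lambda^+$ and is $(\lambda,\lambda^+)$-tame (two types over $M\in K_{\lambda^+}$ with the same restrictions to all $N\preceq M$, $N\in K_\lambda$, are equal). Let $NF$ be a $4$-ary relation on $K_\lambda$ such that, for models in $K_\lambda$: * (a) $NF(M_0,M_1,M_2,M_3)$ implies $M_0\preceq M_n\preceq M_3$ for $n=1,2$ and $M_1\cap M_2=M_0$. * (b) Monotonicity: if $NF(M_0,M_1,M_2,M_3)$, $M_0\preceq N_n\preceq M_n$ and $N_n\preceq N_3$ for $n=1,2$, and $M_3,N_3\preceq N^*$ for some $N^*\in K$, then $NF(M_0,N_1,N_2,N_3)$. * (c) Extension: if $N_0\preceq N_1,N_2$ and $N_1\cap N_2=N_0$, then $NF(N_0,N_1,N_2,N_3)$ for some $N_3$. * (d) Weak uniqueness: if $NF(N_0,N_1,N_2,N_3^a)$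 and $NF(N_0,N_1,N_2,N_3^b)$, then $N_3^a,N_3^b$ have a joint embedding over $N_1\cup N_2$. * (e) Symmetry: $NF(N_0,N_1,N_2,N_3)\Leftrightarrow NF(N_0,N_2,N_1,N_3)$. * (f) Long transitivity: if $\alpha^*>0$, $\langle M_{a,i}:i\le\alpha^*\rangle$ and $\langle M_{b,i}:i\le\alpha^*\rangle$ are increasing continuous and $NF(M_{a,i},M_{a,i+1},M_{b,i},M_{b,i+1})$ for all $i<\alpha^*$, then $NF(M_{a,0},M_{a,\alpha^*},M_{b,0},M_{b,\alpha^*})$. * (g) $NF$ is closed under isomorphisms. Assume that $NF$ respects $\mathfrak{s}$: if $NF(M_0,M_1,M_2,M_3)$, $a\in M_1\setminus M_0$ and $\mathrm{tp}(a,M_0,M_1)$ is basic, then $\mathrm{tp}(a,M_2,M_3)$ does not fork over $M_0$. A filtration of $M\in K_{\lambda^+}$ is a $\preceq$-increasing continuous sequence $\langle M_\alpha:\alpha<\lambda^+\rangle$ in $K_\lambda$ with union $M$. For $N_0,N_1\in K_\lambda$ and $M_0,M_1\in K_{\lambda^+}$, let $\widehat{NF}(N_0,N_1,M_0,M_1)$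 mean that there are filtrations $\langle N_{0,\alpha}\rangle$, $\langle N_{1,\alpha}\rangle$ of $M_0,M_1$ with $N_{0,0}=N_0$, $N_{1,0}=N_1$ and $NF(N_{0,\alpha},N_{1,\alpha},N_{0,\alpha+1},N_{1,\alpha+1})$ for every $\alpha<\lambda^+$. For $M_0,M_1\in K_{\lambda^+}$, let $M_0\preceq^{NF}_{\lambda^+}M_1$ mean that $M_0\preceq M_1$ and $\widehat{NF}(N_0,N_1,M_0,M_1)$ for some $N_0,N_1\in K_\lambda$. Then for all models $M,M^+\in K_{\lambda^+}$: $$M\preceq M^+\iff M\preceq^{NF}_{\lambda^+}M^+ .$$ -/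

import Mathlib

universe u

open FirstOrder FirstOrder.Language Cardinal Order

/-- An `L`-structure whose universe is a set of the cumulative hierarchy (a small class of sets),
so that intersections, unions and literal inclusions of models make sense. -/
structure Model (L : FirstOrder.Language.{u, u}) where
  carrier : Set ZFSet.{u}
  small : Small.{u} carrier
  str : L.Structure carrier

namespace Model

variable {L : FirstOrder.Language.{u, u}}

instance : CoeSort (Model L) (Type (u + 1)) := ⟨fun M => M.carrier⟩

instance (M : Model L) : L.Structure M.carrier := M.str

instance (M : Model L) : Small.{u} M.carrier := M.small

/-- The universe of `M` has cardinality `κ`. -/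
def HasCard (M : Model L) (κ : Cardinal.{u}) : Prop :=
  #M.carrier = Cardinal.lift.{u + 1} κ

/-- `M ⊆ N`: `M` is a substructure of `N`, i.e. the inclusion map is an embedding. -/
def IsSubmodel (M N : Model L) : Prop :=
  ∃ e : M.carrier ↪[L] N.carrier, ∀ x : M, (e x : ZFSet.{u}) = x

/-- For an isomorphism `f : M₁ → N₁` and a substructure `M` of `M₁`: `N = f[M]`, the substructure
of `N₁` whose universe is the image of the universe of `M`. -/
def IsImage {M₁ N₁ : Model L} (f : M₁.carrier ≃[L] N₁.carrier) (M N : Model L) : Prop :=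
  N.IsSubmodel N₁ ∧ N.carrier = {y | ∃ x : M₁, (x : ZFSet.{u}) ∈ M.carrier ∧ (f x : ZFSet.{u}) = y}

/-- `U` is the union of the sequence `⟨A α : α < θ⟩`. -/
def IsUnion (θ : Ordinal.{u}) (A : Ordinal.{u} → Model L) (U : Model L) : Prop :=
  U.carrier = {x | ∃ α < θ, x ∈ (A α).carrier} ∧ ∀ α < θ, (A α).IsSubmodel U

/-- `⟨A α : α < θ⟩` is increasing with respect to `le`, and continuous. -/
structure IncCont (le : Model L → Model L → Prop) (θ : Ordinal.{u})
    (A : Ordinal.{u} → Model L) : Prop where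
  mono : ∀ α β, α ≤ β → β < θ → le (A α) (A β)
  cont : ∀ β, β < θ → IsSuccLimit β → IsUnion β A (A β)

theorem IsSubmodel.antisymm {M N : Model L} (h₁ : M.IsSubmodel N) (h₂ : N.IsSubmodel M) :
    M = N := by
  obtain ⟨⟨⟨e, hinj⟩, hF, hR⟩, he⟩ := h₁
  obtain ⟨e', he'⟩ := h₂
  have he0 : ∀ x : M, (e x : ZFSet.{u}) = x := he
  have hc : M.carrier = N.carrier := by
    ext x
    constructor
    · intro hx
      have := he0 ⟨x, hx⟩
      simp only at this
      rw [← this]; exact (e ⟨x, hx⟩).2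
    · intro hx
      have := he' ⟨x, hx⟩
      simp only at this
      rw [← this]; exact (e' ⟨x, hx⟩).2
  clear he he' e'
  obtain ⟨c, s, str⟩ := M
  obtain ⟨c', s', str'⟩ := N
  obtain rfl : c = c' := hc
  obtain rfl : e = id := funext fun x => Subtype.ext (he0 x)
  congr 1
  refine FirstOrder.Language.Structure.ext ?_ ?_
  · funext n f x
    exact hF f x
  · funext n r x
    exact propext (hR r x).symm

end Model

open Model

/-- An abstract elementary class `(K, ⪯)` in the vocabulary `L`.  Antisymmetry of `⪯` follows from
`sub` and `Model.IsSubmodel.antisymm`. -/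
structure AEC (L : FirstOrder.Language.{u, u}) where
  /-- membership in the class `K` -/
  mem : Model L → Prop
  /-- the relation `⪯` on `K` -/
  le : Model L → Model L → Prop
  le_mem : ∀ {M N}, le M N → mem M ∧ mem N
  le_refl : ∀ {M}, mem M → le M M
  le_trans : ∀ {M N P}, le M N → le N P → le M P
  sub : ∀ {M N}, le M N → M.IsSubmodel N
  /-- closure of `K` and `⪯` under isomorphisms -/
  iso : ∀ {M₀ M₁ N₁ : Model L}, le M₀ M₁ → ∀ f : M₁.carrier ≃[L] N₁.carrier,
    mem N₁ ∧ ∀ N₀, IsImage f M₀ N₀ → le N₀ N₁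
  /-- the union of an increasing continuous sequence is in `K` and extends its members -/
  union : ∀ (δ : Ordinal.{u}) (A : Ordinal.{u} → Model L), IsSuccLimit δ → IncCont le δ A →
    ∃ U, IsUnion δ A U ∧ mem U ∧ le (A 0) U
  /-- smoothness -/
  smooth : ∀ (δ : Ordinal.{u}) (A : Ordinal.{u} → Model L), IsSuccLimit δ → IncCont le δ A →
    ∀ U N, IsUnion δ A U → (∀ α < δ, le (A α) N) → le U N
  /-- coherence -/
  coherence : ∀ {M₀ M₁ M₂}, M₀.IsSubmodel M₁ → le M₀ M₂ → le M₁ M₂ → le M₀ M₁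
  /-- there is a Löwenheim–Skolem–Tarski number -/
  exists_lst : ∃ κ : Cardinal.{u}, ∀ N, mem N → ∀ A ⊆ N.carrier,
    ∃ M, A ⊆ M.carrier ∧ le M N ∧ #M.carrier ≤ Cardinal.lift.{u + 1} κ + #A

namespace AEC

variable {L : FirstOrder.Language.{u, u}} (K : AEC L)

/-- The Löwenheim–Skolem–Tarski number. -/
noncomputable def lst : Cardinal.{u} :=
  sInf {κ : Cardinal.{u} | ∀ N, K.mem N → ∀ A ⊆ N.carrier,
    ∃ M, A ⊆ M.carrier ∧ K.le M N ∧ #M.carrier ≤ Cardinal.lift.{u + 1} κ + #A}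

/-- `M ∈ K_μ`. -/
def InCard (μ : Cardinal.{u}) (M : Model L) : Prop := K.mem M ∧ M.HasCard μ

/-- A `K`-embedding `M → N`: an isomorphism of `M` onto some `range ⪯ N`. -/
structure Emb (M N : Model L) where
  range : Model L
  range_le : K.le range N
  toEquiv : M.carrier ≃[L] range.carrier

variable {K}

/-- The value of a `K`-embedding. -/
def Emb.app {M N : Model L} (f : K.Emb M N) (x : M) : ZFSet.{u} := f.toEquiv x

/-- `f` is over the set `A`: it is the identity on `A`. -/
def Emb.Over {M N : Model L} (f : K.Emb M N) (A : Set ZFSet.{u}) : Prop :=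
  ∀ x : M, (x : ZFSet.{u}) ∈ A → f.app x = x

variable (K)

def JointEmbedding (μ : Cardinal.{u}) : Prop :=
  ∀ M₁ M₂, K.InCard μ M₁ → K.InCard μ M₂ →
    ∃ M₃, K.InCard μ M₃ ∧ Nonempty (K.Emb M₁ M₃) ∧ Nonempty (K.Emb M₂ M₃)

/-- The amalgamation property in `μ`. -/
def Amalgamation (μ : Cardinal.{u}) : Prop :=
  ∀ M₀ M₁ M₂, K.InCard μ M₀ → K.InCard μ M₁ → K.InCard μ M₂ → K.le M₀ M₁ → K.le M₀ M₂ →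
    ∃ M₃, K.InCard μ M₃ ∧ ∃ (f₁ : K.Emb M₁ M₃) (f₂ : K.Emb M₂ M₃),
      f₁.Over M₀.carrier ∧ f₂.Over M₀.carrier

def NoMaximal (μ : Cardinal.{u}) : Prop :=
  ∀ M, K.InCard μ M → ∃ N, K.InCard μ N ∧ K.le M N ∧ M ≠ N

/-- A triple `(M, N, a)` with `M ⪯ N` and `a ∈ N`. -/
structure Triple (M : Model L) where
  top : Model L
  le_top : K.le M top
  elt : top

/-- `(M, N₁, a₁)` and `(M, N₂, a₂)` can be amalgamated over `M` with `a₁`, `a₂` identified. -/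
def Atomic {M : Model L} (t₁ t₂ : K.Triple M) : Prop :=
  ∃ (N : Model L) (f₁ : K.Emb t₁.top N) (f₂ : K.Emb t₂.top N),
    f₁.Over M.carrier ∧ f₂.Over M.carrier ∧ f₁.app t₁.elt = f₂.app t₂.elt

/-- `S(M)`: the Galois (orbital) types over `M`, i.e. the classes of the equivalence relation
generated by `Atomic`. -/
def GType (M : Model L) : Type (u + 1) := Quot (K.Atomic (M := M))

variable {K}

/-- `tp(a, M, N)`. -/
def tp {M N : Model L} (h : K.le M N) (a : N) : K.GType M := Quot.mk _ ⟨N, h, a⟩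

/-- The restriction `p ↾ M` of a type over `N` to `M ⪯ N`. -/
def GType.res {M N : Model L} (h : K.le M N) : K.GType N → K.GType M :=
  Quot.map (fun t => ⟨t.top, K.le_trans h t.le_top, t.elt⟩) (by
    rintro t₁ t₂ ⟨P, f₁, f₂, h₁, h₂, he⟩
    obtain ⟨e, hee⟩ := K.sub h
    have hsub : M.carrier ⊆ N.carrier := fun x hx => by
      have := hee ⟨x, hx⟩
      simp only at this
      rw [← this]; exact (e ⟨x, hx⟩).2
    exact ⟨P, f₁, f₂, fun x hx => h₁ x (hsub hx), fun x hx => h₂ x (hsub hx), he⟩)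

variable (K)

/-- `(κ, μ)`-tameness: types over models in `K_μ` are determined by their restrictions to
submodels in `K_κ`. -/
def Tame (κ μ : Cardinal.{u}) : Prop :=
  ∀ M, K.InCard μ M → ∀ p q : K.GType M,
    (∀ N (h : K.le N M), K.InCard κ N → p.res h = q.res h) → p = q

/-- `S^na(M)`: the non-algebraic types over `M`, for `M ∈ K_lam`. -/
def nonAlg (lam : Cardinal.{u}) (M : Model L) : Set (K.GType M) :=
  {p | ∃ (N : Model L) (h : K.le M N) (a : N), K.InCard lam N ∧ (a : ZFSet.{u}) ∉ M.carrier ∧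
    p = tp h a}

end AEC

/-- The data `(K, ⪯, S^bs, dnf)` of a frame.  `bs M` is meaningful for `M ∈ K_lam` only;
`dnf M₀ M₁ a M₃` says that `a` is free from `M₁` over `M₀` in `M₃`. -/
structure NonForkingFrame (L : FirstOrder.Language.{u, u}) where
  K : AEC L
  bs : (M : Model L) → Set (K.GType M)
  dnf : Model L → Model L → ZFSet.{u} → Model L → Prop

namespace NonForkingFrame

variable {L : FirstOrder.Language.{u, u}} (s : NonForkingFrame L)

/-- The type `p ∈ S(N)` does not fork over `M`. -/
def DoesNotFork (M : Model L) {N : Model L} (p : s.K.GType N) : Prop :=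
  ∃ (N' : Model L) (h : s.K.le N N') (a : N'), p = AEC.tp h a ∧ s.dnf M N a N'

/-- `s` is a semi-good `lam`-frame. -/
structure IsSemiGood (lam : Cardinal.{u}) : Prop where
  infinite : ℵ₀ ≤ lam
  lst_le : s.K.lst ≤ lam
  jep : s.K.JointEmbedding lam
  amalgamation : s.K.Amalgamation lam
  no_maximal : s.K.NoMaximal lam
  bs_sub : ∀ M, s.K.InCard lam M → s.bs M ⊆ s.K.nonAlg lam M
  bs_iso : ∀ (M N M' N' : Model L) (h : s.K.le M N) (h' : s.K.le M' N')
    (f : N.carrier ≃[L] N'.carrier) (a : N), s.K.InCard lam M → s.K.InCard lam N →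
    IsImage f M M' → AEC.tp h a ∈ s.bs M → AEC.tp h' (f a) ∈ s.bs M'
  density : ∀ (M N : Model L) (h : s.K.le M N), s.K.InCard lam M → s.K.InCard lam N → M ≠ N →
    ∃ a : N, (a : ZFSet.{u}) ∉ M.carrier ∧ AEC.tp h a ∈ s.bs M
  /-- basic almost stability -/
  almost_stability : ∀ M, s.K.InCard lam M → #(s.bs M) ≤ Cardinal.lift.{u + 1} (succ lam)
  dnf_dom : ∀ M₀ M₁ a M₃, s.dnf M₀ M₁ a M₃ →
    s.K.InCard lam M₀ ∧ s.K.InCard lam M₁ ∧ s.K.InCard lam M₃ ∧ a ∉ M₁.carrier ∧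
    ∃ (h₀₁ : s.K.le M₀ M₁) (h₁₃ : s.K.le M₁ M₃) (ha : a ∈ M₃.carrier),
      AEC.tp (s.K.le_trans h₀₁ h₁₃) ⟨a, ha⟩ ∈ s.bs M₀ ∧ AEC.tp h₁₃ ⟨a, ha⟩ ∈ s.bs M₁
  dnf_iso : ∀ (M₀ M₁ M₃ N₀ N₁ N₃ : Model L) (f : M₃.carrier ≃[L] N₃.carrier) (a : M₃),
    s.dnf M₀ M₁ a M₃ → IsImage f M₀ N₀ → IsImage f M₁ N₁ → s.dnf N₀ N₁ (f a) N₃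
  monotonicity : ∀ M₀ M₀' M₁' M₁ M₃ M₃' M₃'' a, s.dnf M₀ M₁ a M₃ →
    s.K.le M₀ M₀' → s.K.le M₀' M₁' → s.K.le M₁' M₁ → s.K.le M₃ M₃' → s.K.le M₃'' M₃' →
    s.K.InCard lam M₃' → s.K.InCard lam M₃'' → M₁'.carrier ∪ {a} ⊆ M₃''.carrier →
    s.dnf M₀' M₁' a M₃''
  local_character : ∀ (δ : Ordinal.{u}) (A : Ordinal.{u} → Model L), IsSuccLimit δ →
    δ < (succ lam).ord → IncCont s.K.le (δ + 2) A → (∀ α < δ + 2, s.K.InCard lam (A α)) →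
    ∀ (h : s.K.le (A δ) (A (δ + 1))) (a : A (δ + 1)), AEC.tp h a ∈ s.bs (A δ) →
      ∃ α < δ, s.DoesNotFork (A α) (AEC.tp h a)
  uniqueness : ∀ (M N : Model L) (h : s.K.le M N), s.K.InCard lam M → s.K.InCard lam N →
    ∀ p ∈ s.bs N, ∀ q ∈ s.bs N, s.DoesNotFork M p → s.DoesNotFork M q →
      p.res h = q.res h → p = q
  symmetry : ∀ (M₀ M₁ M₃ : Model L) (h₀₁ : s.K.le M₀ M₁) (h₁₃ : s.K.le M₁ M₃) (a₁ a₂ : M₃),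
    s.K.InCard lam M₀ → s.K.InCard lam M₁ → s.K.InCard lam M₃ → (a₁ : ZFSet.{u}) ∈ M₁.carrier →
    AEC.tp (s.K.le_trans h₀₁ h₁₃) a₁ ∈ s.bs M₀ → s.DoesNotFork M₀ (AEC.tp h₁₃ a₂) →
    ∃ (M₂ M₃' : Model L) (h₂₃ : s.K.le M₂ M₃') (a₁' : M₃'), s.K.InCard lam M₂ ∧
      s.K.InCard lam M₃' ∧ (a₂ : ZFSet.{u}) ∈ M₂.carrier ∧ s.K.le M₀ M₂ ∧ s.K.le M₃ M₃' ∧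
      (a₁' : ZFSet.{u}) = a₁ ∧ s.DoesNotFork M₀ (AEC.tp h₂₃ a₁')
  extension : ∀ (M N : Model L) (h : s.K.le M N), s.K.InCard lam M → s.K.InCard lam N → M ≠ N →
    ∀ p ∈ s.bs M, ∃ q ∈ s.bs N, s.DoesNotFork M q ∧ q.res h = p
  continuity : ∀ (δ : Ordinal.{u}) (A : Ordinal.{u} → Model L), IsSuccLimit δ →
    δ < (succ lam).ord → IncCont s.K.le (δ + 1) A → (∀ α < δ + 1, s.K.InCard lam (A α)) →
    ∀ p : s.K.GType (A δ),
      (∀ α < δ, ∀ h : s.K.le (A α) (A δ), s.DoesNotFork (A 0) (p.res h)) →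
      p ∈ s.bs (A δ) ∧ s.DoesNotFork (A 0) p

end NonForkingFrame

section NonForkingOnModels

variable {L : FirstOrder.Language.{u, u}}

/-- `NF` is a non-forking relation on the models in `K_lam`. -/
structure IsNonForkingRelation (K : AEC L) (lam : Cardinal.{u})
    (NF : Model L → Model L → Model L → Model L → Prop) : Prop where
  dom : ∀ M₀ M₁ M₂ M₃, NF M₀ M₁ M₂ M₃ →
    K.InCard lam M₀ ∧ K.InCard lam M₁ ∧ K.InCard lam M₂ ∧ K.InCard lam M₃
  disjoint : ∀ M₀ M₁ M₂ M₃, NF M₀ M₁ M₂ M₃ →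
    K.le M₀ M₁ ∧ K.le M₁ M₃ ∧ K.le M₀ M₂ ∧ K.le M₂ M₃ ∧
    M₁.carrier ∩ M₂.carrier = M₀.carrier
  monotonicity : ∀ M₀ M₁ M₂ M₃ N₁ N₂ N₃ N', NF M₀ M₁ M₂ M₃ →
    K.le N₁ M₁ → K.le N₂ M₂ → K.le M₀ N₁ → K.le M₀ N₂ → K.le N₁ N₃ → K.le N₂ N₃ →
    K.InCard lam N₃ → K.le M₃ N' → K.le N₃ N' → NF M₀ N₁ N₂ N₃
  extension : ∀ N₀ N₁ N₂, K.InCard lam N₀ → K.InCard lam N₁ → K.InCard lam N₂ →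
    K.le N₀ N₁ → K.le N₀ N₂ → N₁.carrier ∩ N₂.carrier = N₀.carrier →
    ∃ N₃, K.InCard lam N₃ ∧ NF N₀ N₁ N₂ N₃
  weak_uniqueness : ∀ N₀ N₁ N₂ P Q, NF N₀ N₁ N₂ P → NF N₀ N₁ N₂ Q →
    ∃ (N : Model L) (f : K.Emb P N) (g : K.Emb Q N), K.InCard lam N ∧
      f.Over (N₁.carrier ∪ N₂.carrier) ∧ g.Over (N₁.carrier ∪ N₂.carrier)
  symmetry : ∀ N₀ N₁ N₂ N₃, NF N₀ N₁ N₂ N₃ ↔ NF N₀ N₂ N₁ N₃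
  long_transitivity : ∀ (θ : Ordinal.{u}) (A B : Ordinal.{u} → Model L), 0 < θ →
    IncCont K.le (θ + 1) A → IncCont K.le (θ + 1) B →
    (∀ i < θ + 1, K.InCard lam (A i) ∧ K.InCard lam (B i)) →
    (∀ i < θ, NF (A i) (A (i + 1)) (B i) (B (i + 1))) → NF (A 0) (A θ) (B 0) (B θ)
  iso : ∀ (M₀ M₁ M₂ M₃ N₀ N₁ N₂ N₃ : Model L) (f : M₃.carrier ≃[L] N₃.carrier),
    NF M₀ M₁ M₂ M₃ → IsImage f M₀ N₀ → IsImage f M₁ N₁ → IsImage f M₂ N₂ → NF N₀ N₁ N₂ N₃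

/-- `NF` respects the frame `s`. -/
def RespectsFrame (s : NonForkingFrame L) (NF : Model L → Model L → Model L → Model L → Prop) : Prop :=
  ∀ (M₀ M₁ M₂ M₃ : Model L) (h₀₁ : s.K.le M₀ M₁) (h₂₃ : s.K.le M₂ M₃) (a : M₁) (a' : M₃),
    NF M₀ M₁ M₂ M₃ → (a' : ZFSet.{u}) = a → (a : ZFSet.{u}) ∉ M₀.carrier →
    AEC.tp h₀₁ a ∈ s.bs M₀ → s.DoesNotFork M₀ (AEC.tp h₂₃ a')

/-- `⟨A α : α < lam⁺⟩` is a filtration of `M`, a model of cardinality `lam⁺`. -/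
def IsModelFiltration (K : AEC L) (lam : Cardinal.{u}) (A : Ordinal.{u} → Model L)
    (M : Model L) : Prop :=
  IncCont K.le (succ lam).ord A ∧ (∀ α < (succ lam).ord, K.InCard lam (A α)) ∧
    IsUnion (succ lam).ord A M

/-- The relation `NF^(N₀, N₁, M₀, M₁)`, for `N₀, N₁ ∈ K_lam` and `M₀, M₁` of cardinality
`lam⁺`. -/
def NFHat (K : AEC L) (lam : Cardinal.{u}) (NF : Model L → Model L → Model L → Model L → Prop)
    (N₀ N₁ M₀ M₁ : Model L) : Prop :=
  K.InCard lam N₀ ∧ K.InCard lam N₁ ∧ K.InCard (succ lam) M₀ ∧ K.InCard (succ lam) M₁ ∧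
    ∃ A B : Ordinal.{u} → Model L, IsModelFiltration K lam A M₀ ∧ IsModelFiltration K lam B M₁ ∧
      A 0 = N₀ ∧ B 0 = N₁ ∧
      ∀ α < (succ lam).ord, NF (A α) (B α) (A (α + 1)) (B (α + 1))

/-- The relation `M₀ ⪯^NF M₁` on models of cardinality `lam⁺`. -/
def LeNF (K : AEC L) (lam : Cardinal.{u}) (NF : Model L → Model L → Model L → Model L → Prop)
    (M₀ M₁ : Model L) : Prop :=
  K.InCard (succ lam) M₀ ∧ K.InCard (succ lam) M₁ ∧ K.le M₀ M₁ ∧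
    ∃ N₀ N₁, K.InCard lam N₀ ∧ K.InCard lam N₁ ∧ NFHat K lam NF N₀ N₁ M₀ M₁

end NonForkingOnModels

/-!
Only the implication from `⪯` to `⪯^NF` needs a proof. Let `M ⪯ M'` be models in `K_{λ⁺}`.

*Capturing one element.* Suppose `N ⪯ N'` in `K_{λ⁺}` and `N ≠ N'`. By density and local character,
some `a ∈ N' \ N` has, over all members of a filtration of `N`, a basic type that does not fork over
the first member (`IsSemiGood.exists_doesNotFork_filtration`). Copy a model in `K_λ` containing `a`
over that first member and extend it freely along the filtration (`exists_leNF_of_le`): this gives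
`N ⪯^NF D` with a copy `b ∈ D` of `a`. Since the relation respects the frame, the type of `b` over
the members of the filtration does not fork over the first either, so it is the type of `a` by
uniqueness, and tameness gives equality of the types over `N`. Amalgamation in `λ⁺` then puts `D`,
up to an isomorphism over `N`, and `N'` into one model with `a = b` (`exists_leNF_step`).

*Iteration.* Repeating this `λ⁺⁺` times from `M ⪯ M'` gives continuous chains `N_i ⪯ N'_i` with
`N_i ⪯^NF N_{i+1}`, where `N_{i+1}` contains an element of `N'_i \ N_i` unless `N_i = N'_i`. As all
models have cardinality `λ⁺`, there is a limit `i < λ⁺⁺` such that every element of `⋃_{j < i} N'_j`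
that is ever captured lies in `N_i`. Then `N_i = N'_i`, so `M ⪯ M' ⪯ N_i`.

*Collapsing the chain.* Long transitivity, applied to the traces on the chain of the members of a
filtration of `N_i`, shows that `M` is `⪯^NF`-related to everything between `M` and `N_i`
(`leNF_of_chain`).

Two devices are used throughout. Embeddings are handled as functions on `ZFSet`, by which models are
renamed (`Model.map`, `exists_rename`). Clubs of `λ⁺` and `λ⁺⁺` appear as sets of closed points of a
given requirement (`exists_isNormal_closed`), which also takes the place of Fodor's lemma.
-/

/-! ### Submodels, unions and renaming of elements -/

namespace Model

variable {L : FirstOrder.Language.{u, u}}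

theorem IsSubmodel.subset {M N : Model L} (h : M.IsSubmodel N) : M.carrier ⊆ N.carrier := by
  obtain ⟨e, he⟩ := h
  intro x hx
  have h1 := he ⟨x, hx⟩
  simp only at h1
  rw [← h1]
  exact (e ⟨x, hx⟩).2

theorem isSubmodel_iff {M N : Model L} : M.IsSubmodel N ↔ ∃ h : M.carrier ⊆ N.carrier,
    (∀ (n : ℕ) (f : L.Functions n) (x : Fin n → M),
      ((Structure.funMap f x : M) : ZFSet.{u}) =
        (Structure.funMap f (fun i => (⟨x i, h (x i).2⟩ : N)) : N)) ∧
    ∀ (n : ℕ) (r : L.Relations n) (x : Fin n → M),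
      Structure.RelMap r x ↔ Structure.RelMap r (fun i => (⟨x i, h (x i).2⟩ : N)) := by
  constructor
  · rintro ⟨e, he⟩
    have hs : M.carrier ⊆ N.carrier := IsSubmodel.subset ⟨e, he⟩
    have hee : ∀ (n : ℕ) (x : Fin n → M), (fun i => (⟨x i, hs (x i).2⟩ : N)) = e ∘ x := by
      intro n x
      funext i
      exact Subtype.ext (he (x i)).symm
    refine ⟨hs, fun n f x => ?_, fun n r x => ?_⟩
    · rw [hee, ← e.map_fun, he]
    · rw [hee, e.map_rel]
  · rintro ⟨hs, hf, hr⟩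
    refine ⟨⟨⟨Set.inclusion hs, Set.inclusion_injective hs⟩, ?_, ?_⟩, fun x => rfl⟩
    · intro n f x
      exact Subtype.ext (hf n f x)
    · intro n r x
      exact (hr n r x).symm

theorem IsSubmodel.refl (M : Model L) : M.IsSubmodel M :=
  ⟨Embedding.refl L M.carrier, fun _ => rfl⟩

/-- Two submodels of the same model are comparable as soon as their universes are. -/
theorem IsSubmodel.of_subset {M N P : Model L} (h : M.IsSubmodel P) (h' : N.IsSubmodel P)
    (hs : M.carrier ⊆ N.carrier) : M.IsSubmodel N := by
  rw [isSubmodel_iff] at *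
  obtain ⟨hMP, hf, hr⟩ := h
  obtain ⟨hNP, hf', hr'⟩ := h'
  refine ⟨hs, fun n f x => ?_, fun n r x => ?_⟩
  · rw [hf, hf']
  · rw [hr, hr']

theorem IsSubmodel.eq_of_carrier {M N P : Model L} (h : M.IsSubmodel P) (h' : N.IsSubmodel P)
    (hs : M.carrier = N.carrier) : M = N :=
  (h.of_subset h' hs.subset).antisymm (h'.of_subset h hs.symm.subset)

/-- The union of an increasing sequence of models is unique: each tuple of the union lies in one
member of the sequence, which determines the values of the symbols on it. -/
theorem IsUnion.unique {δ : Ordinal.{u}} {A : Ordinal.{u} → Model L} {U V : Model L}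
    (hδ : 0 < δ) (hmono : ∀ α β, α ≤ β → β < δ → (A α).carrier ⊆ (A β).carrier)
    (hU : IsUnion δ A U) (hV : IsUnion δ A V) : U = V := by
  have hc : U.carrier = V.carrier := hU.1.trans hV.1.symm
  have key : ∀ (n : ℕ) (x : Fin n → U), ∃ α < δ, ∀ i, (x i : ZFSet.{u}) ∈ (A α).carrier := by
    intro n x
    have h1 : ∀ i, ∃ α < δ, (x i : ZFSet.{u}) ∈ (A α).carrier := by
      intro i
      exact hU.1.subset (x i).2
    choose a ha hxa using h1
    have hlt : Finset.univ.sup a < δ := by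
      rw [Finset.sup_lt_iff (by simpa using hδ)]
      intro i _
      exact ha i
    exact ⟨Finset.univ.sup a, hlt, fun i => hmono _ _ (Finset.le_sup (Finset.mem_univ i)) hlt
      (hxa i)⟩
  apply IsSubmodel.antisymm
  · rw [isSubmodel_iff]
    refine ⟨hc.subset, fun n f x => ?_, fun n r x => ?_⟩
    · obtain ⟨α, hα, hx⟩ := key n x
      obtain ⟨h1, h2, -⟩ := isSubmodel_iff.1 (hU.2 α hα)
      obtain ⟨h3, h4, -⟩ := isSubmodel_iff.1 (hV.2 α hα)
      exact (h2 n f (fun i => ⟨x i, hx i⟩)).symm.trans (h4 n f (fun i => ⟨x i, hx i⟩))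
    · obtain ⟨α, hα, hx⟩ := key n x
      obtain ⟨h1, -, h2⟩ := isSubmodel_iff.1 (hU.2 α hα)
      obtain ⟨h3, -, h4⟩ := isSubmodel_iff.1 (hV.2 α hα)
      exact (h2 n r (fun i => ⟨x i, hx i⟩)).symm.trans (h4 n r (fun i => ⟨x i, hx i⟩))
  · rw [isSubmodel_iff]
    refine ⟨hc.symm.subset, fun n f x => ?_, fun n r x => ?_⟩
    · obtain ⟨α, hα, hx⟩ := key n (fun i => ⟨x i, hc.symm.subset (x i).2⟩)
      obtain ⟨h1, h2, -⟩ := isSubmodel_iff.1 (hU.2 α hα)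
      obtain ⟨h3, h4, -⟩ := isSubmodel_iff.1 (hV.2 α hα)
      exact (h4 n f (fun i => ⟨x i, hx i⟩)).symm.trans (h2 n f (fun i => ⟨x i, hx i⟩))
    · obtain ⟨α, hα, hx⟩ := key n (fun i => ⟨x i, hc.symm.subset (x i).2⟩)
      obtain ⟨h1, -, h2⟩ := isSubmodel_iff.1 (hU.2 α hα)
      obtain ⟨h3, -, h4⟩ := isSubmodel_iff.1 (hV.2 α hα)
      exact (h4 n r (fun i => ⟨x i, hx i⟩)).symm.trans (h2 n r (fun i => ⟨x i, hx i⟩))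

open Classical in
/-- The model obtained from `M` by renaming each element `x` to `g x`. If `g` is not injective on
the universe of `M`, the junk value is `M` itself. -/
noncomputable def map (g : ZFSet.{u} → ZFSet.{u}) (M : Model L) : Model L :=
  if h : Set.InjOn g M.carrier then
    ⟨g '' M.carrier, inferInstance, (Equiv.Set.imageOfInjOn g M.carrier h).inducedStructure⟩
  else M

theorem exists_mapEquiv {g : ZFSet.{u} → ZFSet.{u}} {M : Model L} (h : Set.InjOn g M.carrier) :
    ∃ f : M.carrier ≃[L] (M.map g).carrier, ∀ x : M, (f x : ZFSet.{u}) = g x := by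
  rw [map, dif_pos h]
  exact ⟨(Equiv.Set.imageOfInjOn g M.carrier h).inducedStructureEquiv, fun x => rfl⟩

theorem carrier_map {g : ZFSet.{u} → ZFSet.{u}} {M : Model L} (h : Set.InjOn g M.carrier) :
    (M.map g).carrier = g '' M.carrier := by
  rw [map, dif_pos h]

theorem isSubmodel_of_embedding {M N : Model L} (e : M.carrier ↪[L] N.carrier)
    (he : ∀ x : M, (e x : ZFSet.{u}) = x) : M.IsSubmodel N := ⟨e, he⟩

theorem map_eq_of_equiv {g : ZFSet.{u} → ZFSet.{u}} {M N : Model L} (f : M.carrier ≃[L] N.carrier)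
    (hf : ∀ x : M, g x = f x) : Set.InjOn g M.carrier ∧ M.map g = N := by
  have hinj : Set.InjOn g M.carrier := by
    intro x hx y hy hxy
    have h1 : f ⟨x, hx⟩ = f ⟨y, hy⟩ := by
      apply Subtype.ext
      rw [← hf, ← hf]
      exact hxy
    exact congrArg Subtype.val (f.injective h1)
  refine ⟨hinj, ?_⟩
  obtain ⟨e, he⟩ := exists_mapEquiv hinj
  apply IsSubmodel.antisymm
  · refine isSubmodel_of_embedding (f.toEmbedding.comp e.symm.toEmbedding) fun x => ?_
    obtain ⟨y, rfl⟩ := e.surjective x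
    simp [he, hf]
  · refine isSubmodel_of_embedding (e.toEmbedding.comp f.symm.toEmbedding) fun x => ?_
    obtain ⟨y, rfl⟩ := f.surjective x
    simp [he, hf]

theorem map_eq_self {g : ZFSet.{u} → ZFSet.{u}} {M : Model L} (hg : ∀ x ∈ M.carrier, g x = x) :
    M.map g = M :=
  (map_eq_of_equiv (Language.Equiv.refl L M.carrier) fun x => hg x x.2).2

theorem map_comp {g k : ZFSet.{u} → ZFSet.{u}} {M : Model L} (hg : Set.InjOn g M.carrier)
    (hk : Set.InjOn k (M.map g).carrier) :
    Set.InjOn (k ∘ g) M.carrier ∧ M.map (k ∘ g) = (M.map g).map k := by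
  obtain ⟨e, he⟩ := exists_mapEquiv hg
  obtain ⟨e', he'⟩ := exists_mapEquiv hk
  refine map_eq_of_equiv (e'.comp e) fun x => ?_
  simp [he, he']

theorem map_congr {g k : ZFSet.{u} → ZFSet.{u}} {M : Model L} (hg : Set.InjOn g M.carrier)
    (h : ∀ x ∈ M.carrier, k x = g x) : M.map k = M.map g := by
  obtain ⟨e, he⟩ := exists_mapEquiv hg
  refine (map_eq_of_equiv e fun x => ?_).2
  rw [he, h x x.2]

theorem IsSubmodel.map {g : ZFSet.{u} → ZFSet.{u}} {M N : Model L} (hg : Set.InjOn g N.carrier)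
    (h : M.IsSubmodel N) : (M.map g).IsSubmodel (N.map g) := by
  obtain ⟨e, he⟩ := exists_mapEquiv hg
  obtain ⟨e', he'⟩ := exists_mapEquiv (hg.mono h.subset)
  obtain ⟨i, hi⟩ := h
  refine isSubmodel_of_embedding ((e.toEmbedding.comp i).comp e'.symm.toEmbedding) fun x => ?_
  obtain ⟨y, rfl⟩ := e'.surjective x
  simp [he, he', hi]

theorem HasCard.map {g : ZFSet.{u} → ZFSet.{u}} {M : Model L} {κ : Cardinal.{u}}
    (hg : Set.InjOn g M.carrier) (h : M.HasCard κ) : (M.map g).HasCard κ := by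
  unfold HasCard at *
  rw [carrier_map hg, ← h]
  exact Cardinal.mk_image_eq_of_injOn g M.carrier hg

/-- The renamed copy of a submodel is its image under the renaming isomorphism. -/
theorem isImage_map {g : ZFSet.{u} → ZFSet.{u}} {M N : Model L} (hg : Set.InjOn g N.carrier)
    (h : M.IsSubmodel N) (f : N.carrier ≃[L] (N.map g).carrier)
    (hf : ∀ x : N, (f x : ZFSet.{u}) = g x) : IsImage f M (M.map g) := by
  refine ⟨h.map hg, ?_⟩
  rw [carrier_map (hg.mono h.subset)]
  ext y
  constructor
  · rintro ⟨x, hx, rfl⟩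
    exact ⟨⟨x, h.subset hx⟩, hx, hf _⟩
  · rintro ⟨x, hx, rfl⟩
    exact ⟨x, hx, (hf x).symm⟩

theorem IsUnion.map {g : ZFSet.{u} → ZFSet.{u}} {δ : Ordinal.{u}} {A : Ordinal.{u} → Model L}
    {U : Model L} (hg : Set.InjOn g U.carrier) (h : IsUnion δ A U) :
    IsUnion δ (fun α => (A α).map g) (U.map g) := by
  refine ⟨?_, fun α hα => (h.2 α hα).map hg⟩
  have hc : ∀ α < δ, ((A α).map g).carrier = g '' (A α).carrier :=
    fun α hα => carrier_map (hg.mono (h.2 α hα).subset)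
  rw [carrier_map hg, h.1]
  ext y
  constructor
  · rintro ⟨x, ⟨α, hα, hx⟩, rfl⟩
    refine ⟨α, hα, ?_⟩
    rw [hc α hα]
    exact ⟨x, hx, rfl⟩
  · rintro ⟨α, hα, hy⟩
    rw [hc α hα] at hy
    obtain ⟨x, hx, rfl⟩ := hy
    exact ⟨x, ⟨α, hα, hx⟩, rfl⟩

end Model

/-- Renaming: an injection `h` of `N` into `Q` can be undone, replacing `h x` by `g x`, by an
injection of `Q` that sends all other elements of `Q` outside a given small set. -/
theorem exists_rename {Q N S : Set ZFSet.{u}} [Small.{u} N] [Small.{u} S]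
    {g h : ZFSet.{u} → ZFSet.{u}} (hg : Set.InjOn g N) (hh : Set.InjOn h N) :
    ∃ k : ZFSet.{u} → ZFSet.{u}, Set.InjOn k Q ∧ (∀ x ∈ N, k (h x) = g x) ∧
      ∀ y, y ∉ h '' N → k y ∉ S := by
  classical
  -- The fresh names are the sets `ZFSet.pair w y`; by foundation, none is an element of `w`.
  obtain ⟨w, hw⟩ : ∃ w : ZFSet.{u}, ∀ z ∈ S ∪ g '' N, z ∈ w :=
    ⟨ZFSet.range (fun z : (S ∪ g '' N : Set ZFSet.{u}) => (z : ZFSet.{u})),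
      fun z hz => ZFSet.mem_range.2 ⟨⟨z, hz⟩, rfl⟩⟩
  have hpair : ∀ y, ZFSet.pair w y ∉ S ∪ g '' N := by
    intro y hy
    have h1 : (ZFSet.pair w y).rank < w.rank := ZFSet.rank_lt_of_mem (hw _ hy)
    have h2 : w.rank < (ZFSet.pair w y).rank := by
      have h3 : w ∈ ({w} : ZFSet.{u}) := by simp
      have h4 : ({w} : ZFSet.{u}) ∈ ZFSet.pair w y := by simp [ZFSet.pair]
      exact (ZFSet.rank_lt_of_mem h3).trans (ZFSet.rank_lt_of_mem h4)
    exact absurd h1 h2.not_gt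
  let k : ZFSet.{u} → ZFSet.{u} := fun y =>
    if hy : y ∈ h '' N then g (Classical.choose hy) else ZFSet.pair w y
  have hk1 : ∀ x ∈ N, k (h x) = g x := by
    intro x hx
    have hy : h x ∈ h '' N := ⟨x, hx, rfl⟩
    simp only [k, dif_pos hy]
    obtain ⟨h1, h2⟩ := Classical.choose_spec hy
    rw [hh h1 hx h2]
  have hk2 : ∀ y, y ∉ h '' N → k y = ZFSet.pair w y := fun y hy => by simp only [k, dif_neg hy]
  refine ⟨k, ?_, hk1, fun y hy => ?_⟩
  · intro x _ y _ hxy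
    by_cases hx : x ∈ h '' N <;> by_cases hy : y ∈ h '' N
    · obtain ⟨x, hx, rfl⟩ := hx
      obtain ⟨y, hy, rfl⟩ := hy
      rw [hk1 x hx, hk1 y hy] at hxy
      rw [hg hx hy hxy]
    · obtain ⟨x, hx, rfl⟩ := hx
      rw [hk1 x hx, hk2 y hy] at hxy
      exact absurd (Or.inr ⟨x, hx, hxy⟩) (hpair y)
    · obtain ⟨y, hy, rfl⟩ := hy
      rw [hk1 y hy, hk2 x hx] at hxy
      exact absurd (Or.inr ⟨y, hy, hxy.symm⟩) (hpair x)
    · rw [hk2 x hx, hk2 y hy] at hxy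
      exact (ZFSet.pair_injective hxy).2
  · rw [hk2 y hy]
    exact fun hs => hpair y (Or.inl hs)

/-! ### Embeddings, unions of chains and Löwenheim–Skolem in an abstract elementary class -/

namespace AEC

variable {L : FirstOrder.Language.{u, u}} {K : AEC L}

theorem subset_of_le {M N : Model L} (h : K.le M N) : M.carrier ⊆ N.carrier := (K.sub h).subset

theorem le_of_subset {M N P : Model L} (h : K.le M P) (h' : K.le N P)
    (hs : M.carrier ⊆ N.carrier) : K.le M N :=
  K.coherence ((K.sub h).of_subset (K.sub h') hs) h h'

theorem eq_of_carrier {M N P : Model L} (h : K.le M P) (h' : K.le N P)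
    (hs : M.carrier = N.carrier) : M = N :=
  (K.sub h).eq_of_carrier (K.sub h') hs

theorem le_map {g : ZFSet.{u} → ZFSet.{u}} {M N : Model L} (hg : Set.InjOn g N.carrier)
    (h : K.le M N) : K.le (M.map g) (N.map g) := by
  obtain ⟨f, hf⟩ := exists_mapEquiv hg
  exact (K.iso h f).2 _ (isImage_map hg (K.sub h) f hf)

theorem InCard.map {κ : Cardinal.{u}} {g : ZFSet.{u} → ZFSet.{u}} {M : Model L}
    (hg : Set.InjOn g M.carrier) (h : K.InCard κ M) : K.InCard κ (M.map g) :=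
  ⟨(K.le_mem (le_map hg (K.le_refl h.1))).1, h.2.map hg⟩

variable (K) in
/-- `g` restricts to a `K`-embedding of `M` into `N`. -/
def IsEmb (g : ZFSet.{u} → ZFSet.{u}) (M N : Model L) : Prop :=
  Set.InjOn g M.carrier ∧ K.le (M.map g) N

theorem isEmb_of_le {M N : Model L} {g : ZFSet.{u} → ZFSet.{u}} (h : K.le M N)
    (hg : ∀ x ∈ M.carrier, g x = x) : K.IsEmb g M N := by
  refine ⟨fun x hx y hy hxy => by rwa [hg x hx, hg y hy] at hxy, ?_⟩
  rwa [map_eq_self hg]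

theorem isEmb_map {M : Model L} {g : ZFSet.{u} → ZFSet.{u}} (h : K.mem M)
    (hg : Set.InjOn g M.carrier) : K.IsEmb g M (M.map g) :=
  ⟨hg, le_map hg (K.le_refl h)⟩

theorem IsEmb.mono_left {M M' N : Model L} {g : ZFSet.{u} → ZFSet.{u}} (h : K.IsEmb g M N)
    (h' : K.le M' M) : K.IsEmb g M' N :=
  ⟨h.1.mono (subset_of_le h'), K.le_trans (le_map h.1 h') h.2⟩

theorem IsEmb.mono_right {M N N' : Model L} {g : ZFSet.{u} → ZFSet.{u}} (h : K.IsEmb g M N)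
    (h' : K.le N N') : K.IsEmb g M N' :=
  ⟨h.1, K.le_trans h.2 h'⟩

theorem IsEmb.image_subset {M N : Model L} {g : ZFSet.{u} → ZFSet.{u}} (h : K.IsEmb g M N) :
    g '' M.carrier ⊆ N.carrier := by
  rw [← carrier_map h.1]
  exact subset_of_le h.2

theorem IsEmb.apply_mem {M N : Model L} {g : ZFSet.{u} → ZFSet.{u}} (h : K.IsEmb g M N)
    {x : ZFSet.{u}} (hx : x ∈ M.carrier) : g x ∈ N.carrier :=
  h.image_subset ⟨x, hx, rfl⟩

theorem IsEmb.comp {M N P : Model L} {g k : ZFSet.{u} → ZFSet.{u}} (hk : K.IsEmb k N P)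
    (hg : K.IsEmb g M N) : K.IsEmb (k ∘ g) M P := by
  have h1 := hk.mono_left hg.2
  obtain ⟨h2, h3⟩ := map_comp hg.1 h1.1
  refine ⟨h2, ?_⟩
  rw [h3]
  exact h1.2

/-- An embedding into `P` with values in `N ⪯ P` is an embedding into `N`. -/
theorem IsEmb.codRestrict {M N P : Model L} {g : ZFSet.{u} → ZFSet.{u}} (hg : K.IsEmb g M P)
    (h : K.le N P) (hs : g '' M.carrier ⊆ N.carrier) : K.IsEmb g M N := by
  refine ⟨hg.1, le_of_subset hg.2 h ?_⟩
  rwa [carrier_map hg.1]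

theorem IsEmb.exists_emb {M N : Model L} {g : ZFSet.{u} → ZFSet.{u}} (h : K.IsEmb g M N) :
    ∃ f : K.Emb M N, ∀ x : M, f.app x = g x := by
  obtain ⟨e, he⟩ := exists_mapEquiv h.1
  exact ⟨⟨M.map g, h.2, e⟩, he⟩

theorem Emb.exists_isEmb {M N : Model L} (f : K.Emb M N) :
    ∃ g : ZFSet.{u} → ZFSet.{u}, K.IsEmb g M N ∧ ∀ x : M, f.app x = g x := by
  classical
  let g : ZFSet.{u} → ZFSet.{u} := fun x => if h : x ∈ M.carrier then f.app ⟨x, h⟩ else x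
  have hg : ∀ x : M, g x = f.app x := fun x => by simp only [g, dif_pos x.2]
  obtain ⟨h1, h2⟩ := map_eq_of_equiv f.toEquiv hg
  refine ⟨g, ⟨h1, ?_⟩, fun x => (hg x).symm⟩
  rw [h2]
  exact f.range_le

theorem _root_.Model.IncCont.mono_length {le : Model L → Model L → Prop} {δ ε : Ordinal.{u}}
    {A : Ordinal.{u} → Model L} (h : IncCont le δ A) (hε : ε ≤ δ) : IncCont le ε A :=
  ⟨fun α β hαβ hβ => h.mono α β hαβ (hβ.trans_le hε), fun β hβ => h.cont β (hβ.trans_le hε)⟩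

/-- The union of an increasing continuous sequence is in `K` and extends all its members: apply the
union axiom to the sequence in which the members before the given one are replaced by it. -/
theorem le_union {δ : Ordinal.{u}} {A : Ordinal.{u} → Model L} {U : Model L} (hδ : IsSuccLimit δ)
    (hA : IncCont K.le δ A) (hU : IsUnion δ A U) {α : Ordinal.{u}} (hα : α < δ) :
    K.le (A α) U := by
  have hδ0 : 0 < δ := hδ.bot_lt
  have hmax : ∀ β < δ, max α β < δ := fun β hβ => max_lt hα hβ
  have h1 : IncCont K.le δ (fun β => A (max α β)) := by
    refine ⟨fun β γ hβγ hγ => hA.mono _ _ (max_le_max_left α hβγ) (hmax γ hγ), ?_⟩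
    intro β hβ hlim
    rcases le_or_gt β α with h | h
    · simp only [max_eq_left h]
      refine ⟨?_, fun γ hγ => ?_⟩
      · ext x
        constructor
        · exact fun hx => ⟨0, hlim.bot_lt, by simpa [max_eq_left] using hx⟩
        · rintro ⟨γ, hγ, hx⟩
          simpa only [max_eq_left (hγ.le.trans h)] using hx
      · simp only [max_eq_left (hγ.le.trans h)]
        exact IsSubmodel.refl _
    · simp only [max_eq_right h.le]
      have h2 := hA.cont β hβ hlim
      refine ⟨?_, fun γ hγ => h2.2 _ (max_lt h hγ)⟩
      rw [h2.1]
      ext x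
      constructor
      · rintro ⟨γ, hγ, hx⟩
        exact ⟨γ, hγ, subset_of_le (hA.mono _ _ (le_max_right _ _) (hmax γ (hγ.trans hβ))) hx⟩
      · rintro ⟨γ, hγ, hx⟩
        exact ⟨_, max_lt h hγ, hx⟩
  obtain ⟨V, hV, -, hle⟩ := K.union δ _ hδ h1
  simp only [max_eq_left (zero_le (a := α))] at hle
  have hUV : IsUnion δ (fun β => A (max α β)) U := by
    refine ⟨?_, fun β hβ => hU.2 _ (hmax β hβ)⟩
    rw [hU.1]
    ext x
    constructor
    · rintro ⟨γ, hγ, hx⟩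
      exact ⟨γ, hγ, subset_of_le (hA.mono _ _ (le_max_right _ _) (hmax γ hγ)) hx⟩
    · rintro ⟨γ, hγ, hx⟩
      exact ⟨_, hmax γ hγ, hx⟩
  have hmono : ∀ β γ, β ≤ γ → γ < δ → (A (max α β)).carrier ⊆ (A (max α γ)).carrier :=
    fun β γ h h' => subset_of_le (h1.mono β γ h h')
  rw [hUV.unique hδ0 hmono hV]
  exact hle

theorem exists_union {δ : Ordinal.{u}} {A : Ordinal.{u} → Model L} (hδ : IsSuccLimit δ)
    (hA : IncCont K.le δ A) : ∃ U, IsUnion δ A U := by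
  obtain ⟨U, hU, -⟩ := K.union δ A hδ hA
  exact ⟨U, hU⟩

theorem _root_.Model.IsUnion.mk_le {δ : Ordinal.{u}} {A : Ordinal.{u} → Model L} {U : Model L}
    {κ : Cardinal.{u}} (hU : IsUnion δ A U) (hκ : ℵ₀ ≤ κ) (hδ : δ.card ≤ κ)
    (hA : ∀ α < δ, #(A α).carrier ≤ Cardinal.lift.{u + 1} κ) :
    #U.carrier ≤ Cardinal.lift.{u + 1} κ := by
  have h1 : U.carrier = ⋃ α ∈ Set.Iio δ, (A α).carrier := by
    rw [hU.1]
    ext x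
    simp
  rw [h1]
  have hκ' : ℵ₀ ≤ Cardinal.lift.{u + 1} κ := Cardinal.aleph0_le_lift.2 hκ
  refine (Cardinal.mk_biUnion_le _ _).trans ?_
  refine (mul_le_mul' (b := Cardinal.lift.{u + 1} κ) (d := Cardinal.lift.{u + 1} κ)
    ?_ ?_).trans (Cardinal.mul_eq_self hκ').le
  · rw [Cardinal.mk_Iio_ordinal]
    exact Cardinal.lift_le.2 hδ
  · exact ciSup_le' fun x => hA x x.2

theorem hasCard_of_le {κ : Cardinal.{u}} {M N : Model L} (hM : M.HasCard κ)
    (h : M.carrier ⊆ N.carrier) (hN : #N.carrier ≤ Cardinal.lift.{u + 1} κ) : N.HasCard κ :=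
  le_antisymm hN (hM.ge.trans (Cardinal.mk_le_mk_of_subset h))

/-- The class `K_κ` is closed under unions of increasing continuous sequences of length at most
`κ`. -/
theorem inCard_union {δ : Ordinal.{u}} {A : Ordinal.{u} → Model L} {U : Model L} {κ : Cardinal.{u}}
    (hκ : ℵ₀ ≤ κ) (hδ : IsSuccLimit δ) (hδκ : δ < (succ κ).ord)
    (hA : IncCont K.le δ A) (hU : IsUnion δ A U) (hc : ∀ α < δ, K.InCard κ (A α)) :
    K.InCard κ U := by
  have h0 := le_union hδ hA hU hδ.bot_lt
  refine ⟨(K.le_mem h0).2, hasCard_of_le (hc 0 hδ.bot_lt).2 (subset_of_le h0) ?_⟩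
  exact hU.mk_le hκ (Order.lt_succ_iff.1 (Cardinal.lt_ord.1 hδκ)) fun α hα => (hc α hα).2.le

theorem lst_spec (K : AEC L) {lam : Cardinal.{u}} (h : K.lst ≤ lam) {N : Model L} (hN : K.mem N)
    {S : Set ZFSet.{u}} (hS : S ⊆ N.carrier) :
    ∃ M, S ⊆ M.carrier ∧ K.le M N ∧ #M.carrier ≤ Cardinal.lift.{u + 1} lam + #S := by
  obtain ⟨M, h1, h2, h3⟩ := (csInf_mem (s := {κ : Cardinal.{u} | ∀ N, K.mem N → ∀ A ⊆ N.carrier,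
    ∃ M : Model L, A ⊆ M.carrier ∧ K.le M N ∧ #M.carrier ≤ Cardinal.lift.{u + 1} κ + #A})
    K.exists_lst) N hN S hS
  exact ⟨M, h1, h2, h3.trans (add_le_add_left (Cardinal.lift_le.2 h) _)⟩

theorem exists_inCard_le (K : AEC L) {lam κ : Cardinal.{u}} (hlam : ℵ₀ ≤ lam) (h : K.lst ≤ lam)
    (hκ : lam ≤ κ) {N : Model L} (hN : K.mem N) (hNκ : Cardinal.lift.{u + 1} κ ≤ #N.carrier)
    {S : Set ZFSet.{u}} (hS : S ⊆ N.carrier) (hSκ : #S ≤ Cardinal.lift.{u + 1} κ) :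
    ∃ M, S ⊆ M.carrier ∧ K.le M N ∧ K.InCard κ M := by
  obtain ⟨T, hTN, hT⟩ := Cardinal.le_mk_iff_exists_subset.1 hNκ
  obtain ⟨M, h1, h2, h3⟩ := K.lst_spec h hN (Set.union_subset hS hTN)
  have hκ' : ℵ₀ ≤ Cardinal.lift.{u + 1} κ := Cardinal.aleph0_le_lift.2 (hlam.trans hκ)
  refine ⟨M, Set.subset_union_left.trans h1, h2, (K.le_mem h2).1, le_antisymm ?_ ?_⟩
  · refine h3.trans (Cardinal.add_le_of_le hκ' (Cardinal.lift_le.2 hκ) ?_)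
    exact (Cardinal.mk_union_le _ _).trans (Cardinal.add_le_of_le hκ' hSκ hT.le)
  · rw [← hT]
    exact Cardinal.mk_le_mk_of_subset (Set.subset_union_right.trans h1)

end AEC

/-- Construction of a continuous sequence by transfinite recursion. Here `R` is the order on the
states, `Lim δ A U` says that `U` is a limit of `⟨A α : α < δ⟩`, `P i` is the invariant of stage
`i`, and `Step i X Y` relates the states of the stages `i` and `i + 1`. -/
theorem exists_chain {T : Type*} (θ : Ordinal.{u}) (R : T → T → Prop)
    (Lim : Ordinal.{u} → (Ordinal.{u} → T) → T → Prop) (P : Ordinal.{u} → T → Prop)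
    (Step : Ordinal.{u} → T → T → Prop) (x₀ : T) (h0 : P 0 x₀)
    (hrefl : ∀ i < θ, ∀ X, P i X → R X X) (htrans : ∀ X Y Z, R X Y → R Y Z → R X Z)
    (hcongr : ∀ δ A B U, (∀ i < δ, A i = B i) → Lim δ A U → Lim δ B U)
    (hstep : ∀ i < θ, ∀ X, P i X → ∃ Y, P (i + 1) Y ∧ R X Y ∧ Step i X Y)
    (hlim : ∀ δ < θ, IsSuccLimit δ → ∀ A : Ordinal.{u} → T, (∀ i j, i ≤ j → j < δ → R (A i) (A j)) →
      (∀ j < δ, IsSuccLimit j → Lim j A (A j)) → (∀ i < δ, P i (A i)) →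
      ∃ U, Lim δ A U ∧ P δ U ∧ ∀ i < δ, R (A i) U) :
    ∃ A : Ordinal.{u} → T, A 0 = x₀ ∧ (∀ i j, i ≤ j → j < θ → R (A i) (A j)) ∧
      (∀ j < θ, IsSuccLimit j → Lim j A (A j)) ∧ (∀ i < θ, P i (A i)) ∧
      ∀ i, i + 1 < θ → Step i (A i) (A (i + 1)) := by
  classical
  let F1 : Ordinal.{u} → T → T := fun i X =>
    if h : ∃ Y, P (i + 1) Y ∧ R X Y ∧ Step i X Y then Classical.choose h else x₀
  let F2 : (δ : Ordinal.{u}) → IsSuccLimit δ → ((o : Ordinal.{u}) → o < δ → T) → T := fun δ _ f =>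
    if h : ∃ U, Lim δ (fun i => if hi : i < δ then f i hi else x₀) U ∧ P δ U ∧
      ∀ i (hi : i < δ), R (f i hi) U then Classical.choose h else x₀
  let A : Ordinal.{u} → T := fun o => Ordinal.limitRecOn o x₀ F1 F2
  have hA0 : A 0 = x₀ := Ordinal.limitRecOn_zero _ _ _
  have hA1 : ∀ i, A (i + 1) = F1 i (A i) := fun i => Ordinal.limitRecOn_add_one _ _ _ _
  have hA2 : ∀ δ (h : IsSuccLimit δ), A δ = F2 δ h fun i _ => A i :=
    fun δ h => Ordinal.limitRecOn_limit _ _ _ _ h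
  have key : ∀ j < θ, P j (A j) ∧ (∀ i ≤ j, R (A i) (A j)) ∧ (IsSuccLimit j → Lim j A (A j)) ∧
      ∀ i, i + 1 = j → Step i (A i) (A j) := by
    intro j
    induction j using Ordinal.limitRecOn with
    | zero =>
      intro hθ
      rw [hA0]
      refine ⟨h0, fun i hi => ?_, fun h => absurd h.bot_lt (lt_irrefl _), fun i hi => ?_⟩
      · rw [nonpos_iff_eq_zero.1 hi, hA0]
        exact hrefl 0 hθ _ h0
      · simp at hi
    | add_one j ih =>
      intro hj
      have hjθ : j < θ := (lt_add_one j).trans hj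
      obtain ⟨hP, hR, -, -⟩ := ih hjθ
      have hex := hstep j hjθ (A j) hP
      have h1 : A (j + 1) = Classical.choose hex := by
        rw [hA1]
        simp only [F1, dif_pos hex]
      obtain ⟨h2, h3, h4⟩ := Classical.choose_spec hex
      rw [← h1] at h2 h3 h4
      refine ⟨h2, fun i hi => ?_, fun h => absurd h (Order.not_isSuccLimit_add_one j), ?_⟩
      · rcases hi.lt_or_eq with h | h
        · exact htrans _ _ _ (hR i (Order.lt_add_one_iff.1 h)) h3
        · rw [h]
          exact hrefl _ hj _ h2
      · intro i hi
        have : i = j := by simpa using hi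
        rw [this]
        exact h4
    | limit j hj ih =>
      intro hjθ
      obtain ⟨U, hU1, hU2, hU3⟩ := hlim j hjθ hj A
        (fun a b hab hb => (ih b hb (hb.trans hjθ)).2.1 a hab)
        (fun b hb => (ih b hb (hb.trans hjθ)).2.2.1) fun i hi => (ih i hi (hi.trans hjθ)).1
      have hex : ∃ U, Lim j (fun i => if hi : i < j then A i else x₀) U ∧ P j U ∧
          ∀ i (_ : i < j), R (A i) U :=
        ⟨U, hcongr j A _ U (fun i hi => by rw [dif_pos hi]) hU1, hU2, hU3⟩
      have h1 : A j = Classical.choose hex := by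
        rw [hA2 j hj]
        simp only [F2]
        exact dif_pos hex
      obtain ⟨h2, h3, h4⟩ := Classical.choose_spec hex
      rw [← h1] at h2 h3 h4
      refine ⟨h3, fun i hi => ?_, fun _ => ?_, fun i hi => ?_⟩
      · rcases hi.lt_or_eq with h | h
        · exact h4 i h
        · rw [h]
          exact hrefl _ hjθ _ h3
      · exact hcongr j _ A _ (fun i hi => by rw [dif_pos hi]) h2
      · rw [← hi] at hj
        exact absurd hj (Order.not_isSuccLimit_add_one i)
  exact ⟨A, hA0, fun i j hij hj => (key j hj).2.1 i hij, fun j hj => (key j hj).2.2.1,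
    fun i hi => (key i hi).1, fun i hi => (key (i + 1) hi).2.2.2 i rfl⟩

/-! ### Bounds and closed points below a successor cardinal -/

theorem isSuccLimit_ord_succ {κ : Cardinal.{u}} (hκ : ℵ₀ ≤ κ) : IsSuccLimit (succ κ).ord :=
  Cardinal.isSuccLimit_ord (hκ.trans (Order.le_succ κ))

theorem add_one_lt_ord_succ {κ : Cardinal.{u}} (hκ : ℵ₀ ≤ κ) {α : Ordinal.{u}}
    (h : α < (succ κ).ord) : α + 1 < (succ κ).ord := by
  have := (isSuccLimit_ord_succ hκ).succ_lt h
  rwa [Order.succ_eq_add_one] at this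

theorem small_of_mk_le {κ : Cardinal.{u}} {T : Type (u + 1)} (h : #T ≤ Cardinal.lift.{u + 1} κ) :
    Small.{u} T := by
  obtain ⟨f⟩ : Nonempty (T ↪ κ.out) := by
    rw [← Cardinal.lift_mk_le', Cardinal.lift_id'.{u, u + 1}, Cardinal.mk_out]
    exact h
  exact small_of_injective f.injective

/-- At most `κ` many eventually true conditions on the ordinals below `κ⁺` are simultaneously true
from some ordinal on. -/
theorem exists_bound {κ : Cardinal.{u}} (hκ : ℵ₀ ≤ κ) {S : Set ZFSet.{u}}
    (hS : #S ≤ Cardinal.lift.{u + 1} κ) {P : ZFSet.{u} → Ordinal.{u} → Prop}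
    (hP : ∀ x ∈ S, ∀ γ γ', γ ≤ γ' → γ' < (succ κ).ord → P x γ → P x γ')
    (h : ∀ x ∈ S, ∃ γ < (succ κ).ord, P x γ) : ∃ γ < (succ κ).ord, ∀ x ∈ S, P x γ := by
  have := small_of_mk_le hS
  choose f hf hPf using fun x : S => h x x.2
  have hreg := Cardinal.isRegular_succ hκ
  have hlt : ⨆ i : Shrink.{u} S, f ((equivShrink S).symm i) < (succ κ).ord := by
    apply Ordinal.iSup_lt_of_lt_cof
    · rw [hreg.cof_ord, Order.lt_succ_iff, ← Cardinal.lift_le.{u + 1}]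
      refine le_trans (le_of_eq ?_) hS
      exact Cardinal.lift_mk_shrink''.{u + 1, u} S
    · exact fun i => hf _
  refine ⟨_, hlt, fun x hx => hP x hx _ _ ?_ hlt (hPf ⟨x, hx⟩)⟩
  have := Ordinal.le_iSup (fun i : Shrink.{u} S => f ((equivShrink S).symm i))
    (equivShrink S ⟨x, hx⟩)
  simpa using this

/-- The closed unbounded set of points closed under a given requirement, enumerated by a normal
function. -/
theorem exists_isNormal_closed {κ : Cardinal.{u}} (hκ : ℵ₀ ≤ κ)
    {Q : Ordinal.{u} → Ordinal.{u} → Prop}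
    (hQ : ∀ β β' γ, β ≤ β' → β' < (succ κ).ord → Q β' γ → Q β γ)
    (h : ∀ β < (succ κ).ord, ∃ γ < (succ κ).ord, Q β γ) {β₀ : Ordinal.{u}}
    (hβ₀ : β₀ < (succ κ).ord) :
    ∃ e : Ordinal.{u} → Ordinal.{u}, IsNormal e ∧ (∀ α < (succ κ).ord, e α < (succ κ).ord) ∧
      ∀ α < (succ κ).ord, β₀ ≤ e α ∧ IsSuccLimit (e α) ∧ ∀ β < e α, ∃ γ < e α, Q β γ := by
  classical
  have h' : ∀ β, ∃ γ, β < (succ κ).ord → γ < (succ κ).ord ∧ Q β γ := fun β => by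
    by_cases hβ : β < (succ κ).ord
    · obtain ⟨γ, h1, h2⟩ := h β hβ
      exact ⟨γ, fun _ => ⟨h1, h2⟩⟩
    · exact ⟨0, fun h => absurd h hβ⟩
  choose g hg using h'
  -- `deriv f` enumerates closed points: those of the form `nfp f a` are limits of iterates of `f`,
  -- each of which satisfies the requirement of the one before.
  let f : Ordinal.{u} → Ordinal.{u} := fun β => max (g β) (max (β + 1) (β₀ + 1))
  have hf : ∀ β < (succ κ).ord, f β < (succ κ).ord := fun β hβ =>
    max_lt (hg β hβ).1 (max_lt (add_one_lt_ord_succ hκ hβ) (add_one_lt_ord_succ hκ hβ₀))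
  have hreg := Cardinal.isRegular_succ hκ
  have hne : succ κ ≠ ℵ₀ := (hκ.trans_lt (Order.lt_succ κ)).ne'
  have he : ∀ α < (succ κ).ord, Ordinal.deriv f α < (succ κ).ord :=
    fun α hα => Cardinal.deriv_lt_ord hreg hne hf hα
  have hn := Ordinal.isNormal_deriv f
  let C : Ordinal.{u} → Prop := fun x => β₀ < x ∧ ∀ β < x, β + 1 < x ∧ ∃ γ < x, Q β γ
  have hC1 : ∀ a < (succ κ).ord, C (Ordinal.nfp f a) := by
    intro a ha
    have hit : ∀ n, f^[n] a < (succ κ).ord := by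
      intro n
      induction n with
      | zero => exact ha
      | succ n ih =>
        rw [Function.iterate_succ_apply']
        exact hf _ ih
    have hlt : ∀ n, f^[n] a < Ordinal.nfp f a := fun n => by
      rw [Ordinal.lt_nfp_iff]
      refine ⟨n + 1, ?_⟩
      rw [Function.iterate_succ_apply']
      exact (lt_add_one _).trans_le ((le_max_left _ _).trans (le_max_right _ _))
    refine ⟨?_, fun β hβ => ?_⟩
    · refine lt_of_lt_of_le ?_ (hlt 1).le
      rw [Function.iterate_succ_apply']
      exact (lt_add_one _).trans_le ((le_max_right _ _).trans (le_max_right _ _))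
    · obtain ⟨n, hn⟩ := Ordinal.lt_nfp_iff.1 hβ
      have h1 := hlt (n + 1)
      rw [Function.iterate_succ_apply'] at h1
      refine ⟨lt_of_le_of_lt ?_ h1, g (f^[n] a), (le_max_left _ _).trans_lt h1,
        hQ _ _ _ hn.le (hit n) (hg _ (hit n)).2⟩
      exact le_trans (by gcongr) ((le_max_left _ _).trans (le_max_right _ _))
  have hC : ∀ α < (succ κ).ord, C (Ordinal.deriv f α) := by
    intro α
    induction α using Ordinal.limitRecOn with
    | zero =>
      intro hα
      rw [Ordinal.deriv_zero_right]
      exact hC1 0 hα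
    | add_one α _ =>
      intro hα
      rw [← Order.succ_eq_add_one, Ordinal.deriv_succ]
      apply hC1
      rw [Order.succ_eq_add_one]
      exact add_one_lt_ord_succ hκ (he α ((lt_add_one α).trans hα))
    | limit α hα ih =>
      intro hαθ
      refine ⟨(ih 0 hα.bot_lt (hα.bot_lt.trans hαθ)).1.trans (hn.strictMono hα.bot_lt), ?_⟩
      intro β hβ
      obtain ⟨i, hi, hβi⟩ := (hn.lt_iff_exists_lt hα).1 hβ
      obtain ⟨h1, γ, h2, h3⟩ := (ih i hi (hi.trans hαθ)).2 β hβi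
      have h4 := hn.strictMono hi
      exact ⟨h1.trans h4, γ, h2.trans h4, h3⟩
  refine ⟨Ordinal.deriv f, hn, he, fun α hα => ⟨(hC α hα).1.le, ?_,
    fun β hβ => ((hC α hα).2 β hβ).2⟩⟩
  refine Ordinal.isSuccLimit_iff.2 ⟨((zero_le (a := β₀)).trans_lt (hC α hα).1).ne', ?_⟩
  refine Order.isSuccPrelimit_of_succ_lt fun β hβ => ?_
  rw [Order.succ_eq_add_one]
  exact ((hC α hα).2 β hβ).1

/-! ### Filtrations -/

theorem Model.IncCont.comp_isNormal {L : FirstOrder.Language.{u, u}} {K : AEC L}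
    {A : Ordinal.{u} → Model L} {δ ε : Ordinal.{u}} (h : IncCont K.le δ A)
    {e : Ordinal.{u} → Ordinal.{u}} (he : IsNormal e) (hlt : ∀ α < ε, e α < δ) :
    IncCont K.le ε (A ∘ e) := by
  refine ⟨fun α β hαβ hβ => h.mono _ _ (he.strictMono.monotone hαβ) (hlt β hβ), ?_⟩
  intro β hβ hlim
  have h1 := h.cont (e β) (hlt β hβ) (he.map_isSuccLimit hlim)
  refine ⟨?_, fun α hα => h1.2 _ (he.strictMono hα)⟩
  ext x
  constructor
  · intro hx
    obtain ⟨γ, hγ, hxγ⟩ := h1.1.subset hx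
    obtain ⟨α, hα, hγα⟩ := (he.lt_iff_exists_lt hlim).1 hγ
    exact ⟨α, hα, AEC.subset_of_le (h.mono _ _ hγα.le (hlt α (hα.trans hβ))) hxγ⟩
  · rintro ⟨α, hα, hx⟩
    exact AEC.subset_of_le (h.mono _ _ (he.strictMono.monotone hα.le) (hlt β hβ)) hx

namespace IsModelFiltration

open AEC

variable {L : FirstOrder.Language.{u, u}} {K : AEC L} {lam : Cardinal.{u}}
  {A : Ordinal.{u} → Model L} {M : Model L}

theorem le (h : IsModelFiltration K lam A M) (hlam : ℵ₀ ≤ lam) {α : Ordinal.{u}}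
    (hα : α < (succ lam).ord) : K.le (A α) M :=
  le_union (isSuccLimit_ord_succ hlam) h.1 h.2.2 hα

theorem subset (h : IsModelFiltration K lam A M) {α β : Ordinal.{u}} (hαβ : α ≤ β)
    (hβ : β < (succ lam).ord) : (A α).carrier ⊆ (A β).carrier :=
  subset_of_le (h.1.mono α β hαβ hβ)

theorem exists_mem (h : IsModelFiltration K lam A M) {x : ZFSet.{u}} (hx : x ∈ M.carrier) :
    ∃ α < (succ lam).ord, x ∈ (A α).carrier :=
  h.2.2.1.subset hx

theorem exists_mem_of_limit (h : IsModelFiltration K lam A M) {α : Ordinal.{u}}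
    (hα : α < (succ lam).ord) (hlim : IsSuccLimit α) {x : ZFSet.{u}} (hx : x ∈ (A α).carrier) :
    ∃ β < α, x ∈ (A β).carrier :=
  (h.1.cont α hα hlim).1.subset hx

theorem exists_subset (h : IsModelFiltration K lam A M) (hlam : ℵ₀ ≤ lam) {S : Set ZFSet.{u}}
    (hS : S ⊆ M.carrier) (hc : #S ≤ Cardinal.lift.{u + 1} lam) :
    ∃ γ < (succ lam).ord, S ⊆ (A γ).carrier :=
  exists_bound (P := fun x γ => x ∈ (A γ).carrier) hlam hc
    (fun _ _ _ _ hγ hγ' hx => h.subset hγ hγ' hx) fun _ hx => h.exists_mem (hS hx)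

/-- A filtration may be replaced by its restriction to a closed unbounded set of indices. -/
theorem comp_isNormal (h : IsModelFiltration K lam A M) (hlam : ℵ₀ ≤ lam)
    {e : Ordinal.{u} → Ordinal.{u}} (he : IsNormal e)
    (hlt : ∀ α < (succ lam).ord, e α < (succ lam).ord) :
    IsModelFiltration K lam (A ∘ e) M := by
  refine ⟨h.1.comp_isNormal he hlt,
    fun α hα => h.2.1 _ (hlt α hα), ?_, fun α hα => h.2.2.2 _ (hlt α hα)⟩
  ext x
  constructor
  · intro hx
    obtain ⟨γ, hγ, hxγ⟩ := h.exists_mem hx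
    exact ⟨γ, hγ, h.subset he.strictMono.le_apply (hlt γ hγ) hxγ⟩
  · rintro ⟨α, hα, hx⟩
    exact subset_of_le (h.le hlam (hlt α hα)) hx

theorem map (h : IsModelFiltration K lam A M) (hlam : ℵ₀ ≤ lam) {g : ZFSet.{u} → ZFSet.{u}}
    (hg : Set.InjOn g M.carrier) :
    IsModelFiltration K lam (fun α => (A α).map g) (M.map g) := by
  have hi : ∀ α < (succ lam).ord, Set.InjOn g (A α).carrier :=
    fun α hα => hg.mono (subset_of_le (h.le hlam hα))
  exact ⟨⟨fun α β hαβ hβ => le_map (hi β hβ) (h.1.mono α β hαβ hβ),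
    fun β hβ hlim => (h.1.cont β hβ hlim).map (hi β hβ)⟩,
    fun α hα => InCard.map (hi α hα) (h.2.1 α hα), h.2.2.map hg⟩

end IsModelFiltration

namespace AEC

variable {L : FirstOrder.Language.{u, u}} {K : AEC L} {lam : Cardinal.{u}}

theorem _root_.Model.IsUnion.congr {δ : Ordinal.{u}} {A B : Ordinal.{u} → Model L} {U : Model L}
    (h : ∀ i < δ, A i = B i) (hU : IsUnion δ A U) : IsUnion δ B U := by
  refine ⟨?_, fun α hα => h α hα ▸ hU.2 α hα⟩
  rw [hU.1]
  ext x
  constructor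
  · rintro ⟨α, hα, hx⟩
    exact ⟨α, hα, h α hα ▸ hx⟩
  · rintro ⟨α, hα, hx⟩
    exact ⟨α, hα, (h α hα).symm ▸ hx⟩

theorem exists_filtration (hlam : ℵ₀ ≤ lam) (hlst : K.lst ≤ lam) {M : Model L}
    (hM : K.InCard (succ lam) M) : ∃ A, IsModelFiltration K lam A M := by
  classical
  have hle : lam ≤ succ lam := Order.le_succ lam
  have hMlam : Cardinal.lift.{u + 1} lam ≤ #M.carrier := by
    rw [hM.2]
    exact Cardinal.lift_le.2 hle
  obtain ⟨g⟩ : Nonempty (Set.Iio (succ lam).ord ≃ M.carrier) := by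
    rw [← Cardinal.eq, Cardinal.mk_Iio_ordinal, Cardinal.card_ord]
    exact hM.2.symm
  obtain ⟨M₀, -, hM₀, hM₀c⟩ := K.exists_inCard_le hlam hlst le_rfl hM.1 hMlam
    (Set.empty_subset M.carrier) (by simp)
  obtain ⟨A, -, h1, h2, h3, h4⟩ := exists_chain (succ lam).ord K.le IsUnion
    (fun _ X => K.le X M ∧ K.InCard lam X)
    (fun i _ Y => ∀ h : i < (succ lam).ord, (g ⟨i, h⟩ : ZFSet.{u}) ∈ Y.carrier) M₀ ⟨hM₀, hM₀c⟩
    (fun _ _ _ hX => K.le_refl hX.2.1) (fun _ _ _ h h' => K.le_trans h h')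
    (fun _ _ _ _ h hU => hU.congr h) (by
      rintro i hi X ⟨hX, hXc⟩
      obtain ⟨Y, hY1, hY2, hY3⟩ := K.exists_inCard_le hlam hlst le_rfl hM.1 hMlam
        (S := X.carrier ∪ {(g ⟨i, hi⟩ : ZFSet.{u})})
        (Set.union_subset (subset_of_le hX) (by simp)) (by
          refine (Cardinal.mk_union_le _ _).trans
            (Cardinal.add_le_of_le (Cardinal.aleph0_le_lift.2 hlam) hXc.2.le ?_)
          rw [Cardinal.mk_singleton]
          exact Cardinal.one_le_aleph0.trans (Cardinal.aleph0_le_lift.2 hlam))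
      exact ⟨Y, ⟨hY2, hY3⟩, le_of_subset hX hY2 (Set.subset_union_left.trans hY1),
        fun _ => hY1 (Or.inr rfl)⟩)
    (by
      intro δ hδ hlim A hmono hcont hP
      have hA : IncCont K.le δ A := ⟨hmono, hcont⟩
      obtain ⟨U, hU⟩ := exists_union hlim hA
      exact ⟨U, hU, ⟨K.smooth δ A hlim hA U M hU fun α hα => (hP α hα).1,
        inCard_union hlam hlim hδ hA hU fun α hα => (hP α hα).2⟩,
        fun i hi => le_union hlim hA hU hi⟩)
  refine ⟨A, ⟨h1, h2⟩, fun α hα => (h3 α hα).2, ?_, fun α hα => K.sub (h3 α hα).1⟩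
  ext x
  constructor
  · intro hx
    obtain ⟨⟨i, hi⟩, hgi⟩ := g.surjective ⟨x, hx⟩
    refine ⟨i + 1, add_one_lt_ord_succ hlam hi, ?_⟩
    have := h4 i (add_one_lt_ord_succ hlam hi) hi
    rwa [hgi] at this
  · rintro ⟨α, hα, hx⟩
    exact subset_of_le (h3 α hα).1 hx

end AEC

/-! ### Amalgamation and Galois types -/

namespace AEC

variable {L : FirstOrder.Language.{u, u}} {K : AEC L}

/-- Amalgamation in which the first model is literally a submodel of the amalgam. -/
theorem Amalgamation.exists_le {κ : Cardinal.{u}} (hAP : K.Amalgamation κ) {M₀ M₁ M₂ : Model L}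
    (h₁ : K.le M₀ M₁) (h₂ : K.le M₀ M₂) (hc₀ : K.InCard κ M₀) (hc₁ : K.InCard κ M₁)
    (hc₂ : K.InCard κ M₂) :
    ∃ (P : Model L) (g : ZFSet.{u} → ZFSet.{u}), K.InCard κ P ∧ K.le M₁ P ∧ K.IsEmb g M₂ P ∧
      ∀ x ∈ M₀.carrier, g x = x := by
  obtain ⟨M₃, hc₃, f₁, f₂, ho₁, ho₂⟩ := hAP M₀ M₁ M₂ hc₀ hc₁ hc₂ h₁ h₂
  obtain ⟨g₁, hg₁, hfg₁⟩ := f₁.exists_isEmb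
  obtain ⟨g₂, hg₂, hfg₂⟩ := f₂.exists_isEmb
  have hs₁ := subset_of_le h₁
  have hs₂ := subset_of_le h₂
  obtain ⟨k, hk, hkg, -⟩ := exists_rename (Q := M₃.carrier) (N := M₁.carrier) (S := ∅)
    (g := id) (h := g₁) (Set.injOn_id _) hg₁.1
  have hkE : K.IsEmb k M₃ (M₃.map k) := isEmb_map hc₃.1 hk
  refine ⟨M₃.map k, k ∘ g₂, hc₃.map hk, ?_, hkE.comp hg₂, fun x hx => ?_⟩
  · have h1 := (hkE.comp hg₁).2
    rwa [map_eq_self (g := k ∘ g₁) hkg] at h1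
  · have h1 : g₁ x = x := by rw [← hfg₁ ⟨x, hs₁ hx⟩, ho₁ _ hx]
    have h2 : g₂ x = x := by rw [← hfg₂ ⟨x, hs₂ hx⟩, ho₂ _ hx]
    have h3 := hkg x (hs₁ hx)
    rw [h1] at h3
    simp only [Function.comp, h2, h3, id]

variable (K) in
/-- `N₁` and `N₂` can be amalgamated over `M` inside `K_κ` with `a₁` and `a₂` identified. -/
def AmalgamIn (κ : Cardinal.{u}) (M N₁ N₂ : Model L) (a₁ a₂ : ZFSet.{u}) : Prop :=
  ∃ (P : Model L) (g₁ g₂ : ZFSet.{u} → ZFSet.{u}), K.InCard κ P ∧ K.IsEmb g₁ N₁ P ∧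
    K.IsEmb g₂ N₂ P ∧ (∀ x ∈ M.carrier, g₁ x = x) ∧ (∀ x ∈ M.carrier, g₂ x = x) ∧ g₁ a₁ = g₂ a₂

theorem AmalgamIn.symm {κ : Cardinal.{u}} {M N₁ N₂ : Model L} {a₁ a₂ : ZFSet.{u}}
    (h : K.AmalgamIn κ M N₁ N₂ a₁ a₂) : K.AmalgamIn κ M N₂ N₁ a₂ a₁ := by
  obtain ⟨P, g₁, g₂, h1, h2, h3, h4, h5, h6⟩ := h
  exact ⟨P, g₂, g₁, h1, h3, h2, h5, h4, h6.symm⟩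

theorem AmalgamIn.trans {κ : Cardinal.{u}} (hAP : K.Amalgamation κ) {M N₁ N₂ N₃ : Model L}
    {a₁ a₂ a₃ : ZFSet.{u}} (hM : K.le M N₂) (hN₂ : K.InCard κ N₂) (ha₂ : a₂ ∈ N₂.carrier)
    (h : K.AmalgamIn κ M N₁ N₂ a₁ a₂) (h' : K.AmalgamIn κ M N₂ N₃ a₂ a₃) :
    K.AmalgamIn κ M N₁ N₃ a₁ a₃ := by
  obtain ⟨P, g₁, g₂, hP, hg₁, hg₂, hM₁, hM₂, hga⟩ := h
  obtain ⟨Q, h₂, h₃, hQ, hh₂, hh₃, hM₂', hM₃, hha⟩ := h'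
  have hs := subset_of_le hM
  obtain ⟨k, hk, hkh, -⟩ := exists_rename (Q := Q.carrier) (N := N₂.carrier) (S := ∅)
    hg₂.1 hh₂.1
  have hkE : K.IsEmb k Q (Q.map k) := isEmb_map hQ.1 hk
  have h1 := (hkE.comp hh₂).2
  rw [map_congr (k := k ∘ h₂) hg₂.1 hkh] at h1
  obtain ⟨R, l, hR, hPR, hl, hlN⟩ := hAP.exists_le hg₂.2 h1 (hN₂.map hg₂.1) hP (hQ.map hk)
  rw [carrier_map hg₂.1] at hlN
  refine ⟨R, g₁, l ∘ (k ∘ h₃), hR, hg₁.mono_right hPR, hl.comp (hkE.comp hh₃), hM₁, ?_, ?_⟩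
  · intro x hx
    have e1 : l (g₂ x) = g₂ x := hlN _ ⟨x, hs hx, rfl⟩
    rw [hM₂ x hx] at e1
    have e2 := hkh x (hs hx)
    rw [hM₂' x hx, hM₂ x hx] at e2
    simp only [Function.comp, hM₃ x hx, e2, e1]
  · simp only [Function.comp]
    rw [hga, ← hha, hkh a₂ ha₂, hlN _ ⟨a₂, ha₂, rfl⟩]

theorem atomic_of_isEmb {M : Model L} {t₁ t₂ : K.Triple M} {N : Model L}
    {g₁ g₂ : ZFSet.{u} → ZFSet.{u}} (h₁ : K.IsEmb g₁ t₁.top N) (h₂ : K.IsEmb g₂ t₂.top N)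
    (hM₁ : ∀ x ∈ M.carrier, g₁ x = x) (hM₂ : ∀ x ∈ M.carrier, g₂ x = x)
    (ha : g₁ t₁.elt = g₂ t₂.elt) : K.Atomic t₁ t₂ := by
  obtain ⟨f₁, hf₁⟩ := h₁.exists_emb
  obtain ⟨f₂, hf₂⟩ := h₂.exists_emb
  refine ⟨N, f₁, f₂, fun x hx => ?_, fun x hx => ?_, ?_⟩
  · rw [hf₁, hM₁ x hx]
  · rw [hf₂, hM₂ x hx]
  · rw [hf₁, hf₂, ha]

theorem tp_eq_of_isEmb {M N N' : Model L} (h : K.le M N) (h' : K.le M N')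
    {g : ZFSet.{u} → ZFSet.{u}} (hg : K.IsEmb g N N') (hM : ∀ x ∈ M.carrier, g x = x)
    {a : N} {b : N'} (hab : g a = b) : tp h a = tp h' b :=
  Quot.sound (atomic_of_isEmb (g₂ := id) hg
    (isEmb_of_le (K.le_refl (K.le_mem h').2) fun _ _ => rfl) hM (fun _ _ => rfl) hab)

theorem tp_eq_of_le {M N N' : Model L} (h : K.le M N) (h' : K.le M N') (hN : K.le N N') {a : N}
    {b : N'} (hab : (a : ZFSet.{u}) = b) : tp h a = tp h' b :=
  tp_eq_of_isEmb (g := id) h h' (isEmb_of_le hN fun _ _ => rfl) (fun _ _ => rfl) hab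

/-- Equality of types over models in `K_κ`, which a priori is witnessed by a chain of amalgams of
arbitrary cardinalities, is witnessed by one amalgam in `K_κ`. -/
theorem amalgamIn_of_tp_eq {lam κ : Cardinal.{u}} (hlam : ℵ₀ ≤ lam) (hlst : K.lst ≤ lam)
    (hκ : lam ≤ κ) (hAP : K.Amalgamation κ) {M N₁ N₂ : Model L} (h₁ : K.le M N₁) (h₂ : K.le M N₂)
    (hM : K.InCard κ M) (hN₁ : K.InCard κ N₁) (hN₂ : K.InCard κ N₂) {a₁ : N₁} {a₂ : N₂}
    (h : tp h₁ a₁ = tp h₂ a₂) : K.AmalgamIn κ M N₁ N₂ a₁ a₂ := by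
  have hκ' : ℵ₀ ≤ Cardinal.lift.{u + 1} κ := Cardinal.aleph0_le_lift.2 (hlam.trans hκ)
  have hatom : ∀ t₁ t₂ : K.Triple M, K.Atomic t₁ t₂ → ∀ P₁ P₂ : Model L,
      K.InCard κ P₁ → K.InCard κ P₂ → K.le P₁ t₁.top → K.le P₂ t₂.top → K.le M P₁ → K.le M P₂ →
      K.AmalgamIn κ M P₁ P₂ t₁.elt t₂.elt := by
    rintro t₁ t₂ ⟨P, f₁, f₂, ho₁, ho₂, he⟩ P₁ P₂ hc₁ hc₂ hP₁ hP₂ hM₁ hM₂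
    obtain ⟨g₁, hg₁, hfg₁⟩ := f₁.exists_isEmb
    obtain ⟨g₂, hg₂, hfg₂⟩ := f₂.exists_isEmb
    have k₁ := hg₁.mono_left hP₁
    have k₂ := hg₂.mono_left hP₂
    have hcard : ∀ {g : ZFSet.{u} → ZFSet.{u}} {Q : Model L}, K.InCard κ Q →
        #(g '' Q.carrier) ≤ Cardinal.lift.{u + 1} κ := fun hQ => Cardinal.mk_image_le.trans hQ.2.le
    obtain ⟨Q, hQ1, hQ2, hQ3⟩ := K.exists_inCard_le (κ := κ) hlam hlst hκ (K.le_mem k₁.2).2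
      (S := g₁ '' P₁.carrier ∪ g₂ '' P₂.carrier) (by
        rw [← (hc₁.map k₁.1).2]
        exact Cardinal.mk_le_mk_of_subset (subset_of_le k₁.2))
      (Set.union_subset k₁.image_subset k₂.image_subset)
      ((Cardinal.mk_union_le _ _).trans (Cardinal.add_le_of_le hκ' (hcard hc₁) (hcard hc₂)))
    refine ⟨Q, g₁, g₂, hQ3, k₁.codRestrict hQ2 (Set.subset_union_left.trans hQ1),
      k₂.codRestrict hQ2 (Set.subset_union_right.trans hQ1), fun x hx => ?_, fun x hx => ?_, ?_⟩
    · rw [← hfg₁ ⟨x, subset_of_le t₁.le_top hx⟩, ho₁ _ hx]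
    · rw [← hfg₂ ⟨x, subset_of_le t₂.le_top hx⟩, ho₂ _ hx]
    · rw [← hfg₁, ← hfg₂, he]
  have key : ∀ t₁ t₂ : K.Triple M, Relation.EqvGen K.Atomic t₁ t₂ → ∀ P₁ P₂ : Model L,
      K.InCard κ P₁ → K.InCard κ P₂ → K.le P₁ t₁.top → K.le P₂ t₂.top → K.le M P₁ → K.le M P₂ →
      K.AmalgamIn κ M P₁ P₂ t₁.elt t₂.elt := by
    intro t₁ t₂ ht
    induction ht with
    | rel t₁ t₂ ht => exact hatom t₁ t₂ ht
    | refl t =>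
      have hid : K.IsEmb id t.top t.top :=
        isEmb_of_le (K.le_refl (K.le_mem t.le_top).2) fun _ _ => rfl
      exact hatom t t (atomic_of_isEmb hid hid (fun _ _ => rfl) (fun _ _ => rfl) rfl)
    | symm t₁ t₂ _ ih =>
      intro P₁ P₂ hc₁ hc₂ hP₁ hP₂ hM₁ hM₂
      exact (ih P₂ P₁ hc₂ hc₁ hP₂ hP₁ hM₂ hM₁).symm
    | trans t₁ t₂ t₃ _ _ ih₁ ih₂ =>
      intro P₁ P₃ hc₁ hc₃ hP₁ hP₃ hM₁ hM₃
      have hs := subset_of_le t₂.le_top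
      obtain ⟨P₂, k1, k2, k3⟩ := K.exists_inCard_le (κ := κ) hlam hlst hκ (K.le_mem t₂.le_top).2
        (S := M.carrier ∪ {(t₂.elt : ZFSet.{u})}) (by
          rw [← hM.2]
          exact Cardinal.mk_le_mk_of_subset hs)
        (Set.union_subset hs (by simp))
        ((Cardinal.mk_union_le _ _).trans (Cardinal.add_le_of_le hκ' hM.2.le (by
          rw [Cardinal.mk_singleton]
          exact Cardinal.one_le_aleph0.trans hκ')))
      have hMP₂ : K.le M P₂ := le_of_subset t₂.le_top k2 (Set.subset_union_left.trans k1)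
      exact (ih₁ P₁ P₂ hc₁ k3 hP₁ k2 hM₁ hMP₂).trans hAP hMP₂ k3 (k1 (Or.inr rfl))
        (ih₂ P₂ P₃ k3 hc₃ k2 hP₃ hMP₂ hM₃)
  exact key _ _ (Quot.eqvGen_exact h) N₁ N₂ hN₁ hN₂ (K.le_refl hN₁.1) (K.le_refl hN₂.1) h₁ h₂

/-- If `a₁` and `a₂` have the same type over `M`, then `N₁` has an extension into which `N₂` embeds
over `M` with `a₂` going to `a₁`. -/
theorem exists_le_of_tp_eq {lam κ : Cardinal.{u}} (hlam : ℵ₀ ≤ lam) (hlst : K.lst ≤ lam)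
    (hκ : lam ≤ κ) (hAP : K.Amalgamation κ) {M N₁ N₂ : Model L} (h₁ : K.le M N₁) (h₂ : K.le M N₂)
    (hM : K.InCard κ M) (hN₁ : K.InCard κ N₁) (hN₂ : K.InCard κ N₂) {a₁ : N₁} {a₂ : N₂}
    (h : tp h₁ a₁ = tp h₂ a₂) :
    ∃ (P : Model L) (g : ZFSet.{u} → ZFSet.{u}), K.InCard κ P ∧ K.le N₁ P ∧ K.IsEmb g N₂ P ∧
      (∀ x ∈ M.carrier, g x = x) ∧ g a₂ = a₁ := by
  obtain ⟨P, g₁, g₂, hP, hg₁, hg₂, hM₁, hM₂, hga⟩ :=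
    amalgamIn_of_tp_eq hlam hlst hκ hAP h₁ h₂ hM hN₁ hN₂ h
  obtain ⟨k, hk, hkg, -⟩ := exists_rename (Q := P.carrier) (N := N₁.carrier) (S := ∅)
    (g := id) (h := g₁) (Set.injOn_id _) hg₁.1
  have hkE : K.IsEmb k P (P.map k) := isEmb_map hP.1 hk
  refine ⟨P.map k, k ∘ g₂, hP.map hk, ?_, hkE.comp hg₂, fun x hx => ?_, ?_⟩
  · have h1 := (hkE.comp hg₁).2
    rwa [map_eq_self (g := k ∘ g₁) hkg] at h1
  · have h3 := hkg x (subset_of_le h₁ hx)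
    rw [hM₁ x hx] at h3
    simp only [Function.comp, hM₂ x hx, h3, id]
  · simp only [Function.comp]
    rw [← hga, hkg _ a₁.2, id]

end AEC

namespace NonForkingFrame

open AEC

variable {L : FirstOrder.Language.{u, u}} {s : NonForkingFrame L} {lam : Cardinal.{u}}

/-- Non-forking is preserved when the base grows and the domain shrinks. -/
theorem DoesNotFork.res (hs : s.IsSemiGood lam) {M₀ M₀' M₁' M₁ : Model L} {p : s.K.GType M₁}
    (hp : s.DoesNotFork M₀ p) (h₀ : s.K.le M₀ M₀') (h₀₁ : s.K.le M₀' M₁') (h₁ : s.K.le M₁' M₁) :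
    s.DoesNotFork M₀' (p.res h₁) := by
  obtain ⟨N, h, a, rfl, hd⟩ := hp
  have hN := (hs.dnf_dom _ _ _ _ hd).2.2.1
  have hNN := s.K.le_refl hN.1
  refine ⟨N, s.K.le_trans h₁ h, a, rfl, ?_⟩
  refine hs.monotonicity _ _ _ _ _ _ _ _ hd h₀ h₀₁ h₁ hNN hNN hN hN ?_
  refine Set.union_subset (subset_of_le (s.K.le_trans h₁ h)) ?_
  simp

theorem DoesNotFork.mem_bs (hs : s.IsSemiGood lam) {M N : Model L} {p : s.K.GType N}
    (hp : s.DoesNotFork M p) : p ∈ s.bs N := by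
  obtain ⟨N', h, a, rfl, hd⟩ := hp
  obtain ⟨-, -, -, -, _, _, _, -, h1⟩ := hs.dnf_dom _ _ _ _ hd
  exact h1

/-- Local character for a continuous sequence and an extension of its last member. -/
theorem IsSemiGood.exists_doesNotFork (hs : s.IsSemiGood lam) {δ : Ordinal.{u}}
    {A : Ordinal.{u} → Model L} (hδ : IsSuccLimit δ) (hδ' : δ < (succ lam).ord)
    (hA : IncCont s.K.le (δ + 1) A) (hc : ∀ α < δ + 1, s.K.InCard lam (A α)) {N : Model L}
    (hN : s.K.InCard lam N) (h : s.K.le (A δ) N) (a : N) (ha : tp h a ∈ s.bs (A δ)) :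
    ∃ α < δ, s.DoesNotFork (A α) (tp h a) := by
  classical
  let A' : Ordinal.{u} → Model L := fun i => if i < δ + 1 then A i else N
  have h1 : ∀ i < δ + 1, A' i = A i := fun i hi => if_pos hi
  have h2 : A' (δ + 1) = N := if_neg (lt_irrefl _)
  have h2' : ∀ i, ¬ i < δ + 1 → A' i = N := fun i hi => if_neg hi
  have hlt : ∀ i, i < δ + 2 → ¬ i < δ + 1 → i = δ + 1 := by
    intro i hi hi'
    have h3 : δ + 2 = δ + 1 + 1 := by rw [add_assoc, one_add_one_eq_two]
    rw [h3] at hi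
    exact le_antisymm (Order.lt_add_one_iff.1 hi) (not_lt.1 hi')
  have hA' : IncCont s.K.le (δ + 2) A' := by
    refine ⟨fun i j hij hj => ?_, fun j hj hlim => ?_⟩
    · by_cases hj' : j < δ + 1
      · rw [h1 j hj', h1 i (hij.trans_lt hj')]
        exact hA.mono i j hij hj'
      · rw [h2' j hj']
        by_cases hi' : i < δ + 1
        · rw [h1 i hi']
          exact s.K.le_trans (hA.mono i δ (Order.lt_add_one_iff.1 hi') (lt_add_one δ)) h
        · rw [h2' i hi']
          exact s.K.le_refl hN.1
    · have hj' : j < δ + 1 := by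
        by_contra hj'
        rw [hlt j hj hj'] at hlim
        exact Order.not_isSuccLimit_add_one δ hlim
      rw [h1 j hj']
      exact (hA.cont j hj' hlim).congr fun i hi => (h1 i (hi.trans hj')).symm
  have hc' : ∀ i < δ + 2, s.K.InCard lam (A' i) := by
    intro i hi
    by_cases hi' : i < δ + 1
    · rw [h1 i hi']
      exact hc i hi'
    · rw [h2' i hi']
      exact hN
  have key : ∀ Y Z, A' δ = Y → A' (δ + 1) = Z → ∀ (h : s.K.le Y Z) (a : Z), tp h a ∈ s.bs Y →
      ∃ i < δ, s.DoesNotFork (A' i) (tp h a) := by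
    rintro _ _ rfl rfl h a ha
    exact hs.local_character δ A' hδ hδ' hA' hc' h a ha
  obtain ⟨i, hi, hd⟩ := key _ _ (h1 δ (lt_add_one δ)) h2 h a ha
  rw [h1 i (hi.trans (lt_add_one δ))] at hd
  exact ⟨i, hi, hd⟩

end NonForkingFrame

/-! ### The non-forking relation on filtrations -/

section NonForkingRelation

open AEC

variable {L : FirstOrder.Language.{u, u}} {K : AEC L} {lam : Cardinal.{u}}
  {NF : Model L → Model L → Model L → Model L → Prop}

namespace IsNonForkingRelation

theorem map (h : IsNonForkingRelation K lam NF) {M₀ M₁ M₂ M₃ : Model L}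
    {g : ZFSet.{u} → ZFSet.{u}} (hg : Set.InjOn g M₃.carrier) (hNF : NF M₀ M₁ M₂ M₃) :
    NF (M₀.map g) (M₁.map g) (M₂.map g) (M₃.map g) := by
  obtain ⟨h01, h13, h02, h23, -⟩ := h.disjoint _ _ _ _ hNF
  obtain ⟨f, hf⟩ := exists_mapEquiv hg
  exact h.iso _ _ _ _ _ _ _ _ f hNF (isImage_map hg (K.sub (K.le_trans h01 h13)) f hf)
    (isImage_map hg (K.sub h13) f hf) (isImage_map hg (K.sub h23) f hf)

theorem refl_left (h : IsNonForkingRelation K lam NF) {M N P : Model L} (hM : K.InCard lam M)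
    (hN : K.InCard lam N) (hP : K.InCard lam P) (hMN : K.le M N) (hNP : K.le N P) :
    NF M M N P := by
  obtain ⟨Q, hQ, hNF⟩ := h.extension M M N hM hM hN (K.le_refl hM.1) hMN
    (Set.inter_eq_left.2 (subset_of_le hMN))
  have hM' := K.le_refl hM.1
  have hN' := K.le_refl hN.1
  have hNQ := (h.disjoint _ _ _ _ hNF).2.2.2.1
  have h1 : NF M M N N :=
    h.monotonicity M M N Q M N N Q hNF hM' hN' hM' hMN hMN hN' hN (K.le_refl hQ.1) hNQ
  exact h.monotonicity M M N N M N P P h1 hM' hN' hM' hMN (K.le_trans hMN hNP) hNP hP hNP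
    (K.le_refl hP.1)

/-- The relation may be transferred along two filtrations from successive to arbitrary indices. -/
theorem of_lt (h : IsNonForkingRelation K lam NF) {A B : Ordinal.{u} → Model L} {M N : Model L}
    (hA : IsModelFiltration K lam A M) (hB : IsModelFiltration K lam B N)
    (hNF : ∀ α < (succ lam).ord, NF (A α) (B α) (A (α + 1)) (B (α + 1))) {α β : Ordinal.{u}}
    (hαβ : α < β) (hβ : β < (succ lam).ord) : NF (A α) (B α) (A β) (B β) := by
  have hlt : ∀ i < β - α + 1, α + i < (succ lam).ord := by
    intro i hi
    refine lt_of_le_of_lt ?_ hβ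
    rw [← Ordinal.add_sub_cancel_of_le hαβ.le]
    exact (add_le_add_iff_left α).2 (Order.lt_add_one_iff.1 hi)
  have hn := Ordinal.isNormal_add_right α
  have h1 := h.long_transitivity (β - α) (A ∘ (α + ·)) (B ∘ (α + ·))
    (by rwa [Ordinal.lt_sub, add_zero]) (hA.1.comp_isNormal hn hlt) (hB.1.comp_isNormal hn hlt)
    (fun i hi => ⟨hA.2.1 _ (hlt i hi), hB.2.1 _ (hlt i hi)⟩) (fun i hi => by
      have h2 := hNF (α + i) (hlt i (hi.trans (lt_add_one _)))
      rw [h.symmetry, add_assoc] at h2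
      exact h2)
  simp only [Function.comp, add_zero, Ordinal.add_sub_cancel_of_le hαβ.le] at h1
  exact (h.symmetry _ _ _ _).1 h1

end IsNonForkingRelation

/-- The relation `LeNF` in terms of two filtrations. -/
theorem leNF_iff (hlam : ℵ₀ ≤ lam) {M N : Model L} (hM : K.InCard (succ lam) M)
    (hN : K.InCard (succ lam) N) (hle : K.le M N) :
    LeNF K lam NF M N ↔ ∃ A B : Ordinal.{u} → Model L, IsModelFiltration K lam A M ∧
      IsModelFiltration K lam B N ∧
      ∀ α < (succ lam).ord, NF (A α) (B α) (A (α + 1)) (B (α + 1)) := by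
  constructor
  · rintro ⟨-, -, -, N₀, N₁, -, -, -, -, -, -, A, B, hA, hB, -, -, hNF⟩
    exact ⟨A, B, hA, hB, hNF⟩
  · rintro ⟨A, B, hA, hB, hNF⟩
    have h0 : (0 : Ordinal.{u}) < (succ lam).ord := (isSuccLimit_ord_succ hlam).bot_lt
    exact ⟨hM, hN, hle, A 0, B 0, hA.2.1 0 h0, hB.2.1 0 h0, hA.2.1 0 h0, hB.2.1 0 h0, hM, hN, A, B,
      hA, hB, rfl, rfl, hNF⟩

/-- `LeNF` is invariant under isomorphisms over the smaller model. -/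
theorem LeNF.map (h : IsNonForkingRelation K lam NF) (hlam : ℵ₀ ≤ lam) {M N : Model L}
    (hMN : LeNF K lam NF M N) {g : ZFSet.{u} → ZFSet.{u}} (hg : Set.InjOn g N.carrier)
    (hgM : ∀ x ∈ M.carrier, g x = x) : LeNF K lam NF M (N.map g) := by
  have hM := hMN.1
  have hN := hMN.2.1
  have hle := hMN.2.2.1
  have hle' : K.le M (N.map g) := by
    have := le_map hg hle
    rwa [map_eq_self hgM] at this
  rw [leNF_iff hlam hM hN hle] at hMN
  rw [leNF_iff hlam hM (hN.map hg) hle']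
  obtain ⟨A, B, hA, hB, hNF⟩ := hMN
  refine ⟨A, _, hA, hB.map hlam hg, fun α hα => ?_⟩
  have hα' := add_one_lt_ord_succ hlam hα
  have hAs : ∀ α < (succ lam).ord, (A α).map g = A α :=
    fun α hα => map_eq_self fun x hx => hgM x (subset_of_le (hA.le hlam hα) hx)
  have h1 := h.map (hg.mono (subset_of_le (hB.le hlam hα'))) (hNF α hα)
  rwa [hAs α hα, hAs _ hα'] at h1

theorem LeNF.refl (h : IsNonForkingRelation K lam NF) (hlam : ℵ₀ ≤ lam) (hlst : K.lst ≤ lam)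
    {M : Model L} (hM : K.InCard (succ lam) M) : LeNF K lam NF M M := by
  obtain ⟨A, hA⟩ := exists_filtration hlam hlst hM
  rw [leNF_iff hlam hM hM (K.le_refl hM.1)]
  refine ⟨A, A, hA, hA, fun α hα => ?_⟩
  have hα' := add_one_lt_ord_succ hlam hα
  exact h.refl_left (hA.2.1 α hα) (hA.2.1 _ hα') (hA.2.1 _ hα')
    (hA.1.mono _ _ (lt_add_one α).le hα') (K.le_refl (hA.2.1 _ hα').1)

/-- A model `B₀ ∈ K_λ` extending the first member of a filtration of `M` can be freely extended
along the filtration, up to an isomorphism over that member. -/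
theorem exists_leNF_of_le (h : IsNonForkingRelation K lam NF) (hlam : ℵ₀ ≤ lam) {M : Model L}
    (hM : K.InCard (succ lam) M) {A : Ordinal.{u} → Model L} (hA : IsModelFiltration K lam A M)
    {B₀ : Model L} (hB₀ : K.InCard lam B₀) (hAB : K.le (A 0) B₀) :
    ∃ (D : Ordinal.{u} → Model L) (N : Model L) (g : ZFSet.{u} → ZFSet.{u}),
      K.InCard (succ lam) N ∧ K.le M N ∧ IsModelFiltration K lam D N ∧
      Set.InjOn g B₀.carrier ∧ (∀ x ∈ (A 0).carrier, g x = x) ∧ D 0 = B₀.map g ∧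
      ∀ α < (succ lam).ord, NF (A α) (D α) (A (α + 1)) (D (α + 1)) := by
  have hθ := isSuccLimit_ord_succ hlam
  have h0 : (0 : Ordinal.{u}) < (succ lam).ord := hθ.bot_lt
  obtain ⟨g, hg, hgA, hgM⟩ := exists_rename (Q := B₀.carrier) (N := (A 0).carrier)
    (S := M.carrier) (g := id) (h := id) (Set.injOn_id _) (Set.injOn_id _)
  simp only [id, Set.image_id'] at hgA hgM
  have hA0M := subset_of_le (hA.le hlam h0)
  obtain ⟨D, hD0, hD1, hD2, hD3, hD4⟩ := exists_chain (succ lam).ord K.le IsUnion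
    (fun i X => i < (succ lam).ord → K.le (A i) X ∧ X.carrier ∩ M.carrier = (A i).carrier ∧
      K.InCard lam X)
    (fun i X Y => NF (A i) X (A (i + 1)) Y) (B₀.map g) (by
      intro _
      have h1 : K.le (A 0) (B₀.map g) := by
        have := le_map hg hAB
        rwa [map_eq_self hgA] at this
      refine ⟨h1, ?_, hB₀.map hg⟩
      apply subset_antisymm
      · rw [carrier_map hg]
        rintro _ ⟨⟨y, hy, rfl⟩, hyM⟩
        by_cases hyA : y ∈ (A 0).carrier
        · rwa [hgA y hyA]
        · exact absurd hyM (hgM y hyA)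
      · exact Set.subset_inter (subset_of_le h1) hA0M)
    (fun i hi X hX => K.le_refl (hX hi).2.2.1) (fun _ _ _ h h' => K.le_trans h h')
    (fun _ _ _ _ h hU => hU.congr h) (by
      intro i hi X hX
      obtain ⟨hX1, hX2, hX3⟩ := hX hi
      have hi' := add_one_lt_ord_succ hlam hi
      have hAi := hA.1.mono i (i + 1) (lt_add_one i).le hi'
      have hAM := subset_of_le (hA.le hlam hi')
      obtain ⟨Y, hY, hNF⟩ := h.extension (A i) X (A (i + 1)) (hA.2.1 i hi) hX3 (hA.2.1 _ hi') hX1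
        hAi (by
          apply subset_antisymm
          · rw [← hX2]
            exact Set.inter_subset_inter_right _ hAM
          · exact Set.subset_inter (subset_of_le hX1) (subset_of_le hAi))
      obtain ⟨-, hXY, -, hAY, -⟩ := h.disjoint _ _ _ _ hNF
      -- The elements of `Y` outside `X ∪ A (i + 1)` are renamed, so that `Y ∩ M = A (i + 1)`.
      obtain ⟨k, hk, hkid, hkM⟩ := exists_rename (Q := Y.carrier)
        (N := X.carrier ∪ (A (i + 1)).carrier) (S := M.carrier) (g := id) (h := id)
        (Set.injOn_id _) (Set.injOn_id _)
      simp only [id, Set.image_id'] at hkid hkM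
      have hkX : X.map k = X := map_eq_self fun x hx => hkid x (Or.inl hx)
      have hkA : (A (i + 1)).map k = A (i + 1) := map_eq_self fun x hx => hkid x (Or.inr hx)
      have hkA' : (A i).map k = A i :=
        map_eq_self fun x hx => hkid x (Or.inl (subset_of_le hX1 hx))
      have hXY' := le_map hk hXY
      have hAY' := le_map hk hAY
      have hNF' := h.map hk hNF
      rw [hkX] at hXY' hNF'
      rw [hkA] at hAY' hNF'
      rw [hkA'] at hNF'
      refine ⟨Y.map k, fun _ => ⟨hAY', ?_, hY.map hk⟩, hXY', hNF'⟩
      apply subset_antisymm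
      · rw [carrier_map hk]
        rintro _ ⟨⟨y, hy, rfl⟩, hyM⟩
        by_cases hyA : y ∈ X.carrier ∪ (A (i + 1)).carrier
        · rw [hkid y hyA] at hyM ⊢
          rcases hyA with hyX | hyA
          · exact subset_of_le hAi (hX2.subset ⟨hyX, hyM⟩)
          · exact hyA
        · exact absurd hyM (hkM y hyA)
      · exact Set.subset_inter (subset_of_le hAY') hAM)
    (by
      intro δ hδ hlim D hmono hcont hP
      have hD : IncCont K.le δ D := ⟨hmono, hcont⟩
      have hP' := fun i (hi : i < δ) => hP i hi (hi.trans hδ)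
      obtain ⟨U, hU⟩ := exists_union hlim hD
      have hDU : ∀ i < δ, K.le (D i) U := fun i hi => le_union hlim hD hU hi
      refine ⟨U, hU, fun _ => ⟨?_, ?_, ?_⟩, hDU⟩
      · exact K.smooth δ A hlim (hA.1.mono_length hδ.le) _ _ (hA.1.cont δ hδ hlim)
          fun i hi => K.le_trans (hP' i hi).1 (hDU i hi)
      · apply subset_antisymm
        · rintro x ⟨hxU, hxM⟩
          obtain ⟨i, hi, hx⟩ := hU.1.subset hxU
          exact hA.subset hi.le hδ ((hP' i hi).2.1.subset ⟨hx, hxM⟩)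
        · intro x hx
          refine ⟨?_, subset_of_le (hA.le hlam hδ) hx⟩
          obtain ⟨i, hi, hxi⟩ := hA.exists_mem_of_limit hδ hlim hx
          exact subset_of_le (hDU i hi) (subset_of_le (hP' i hi).1 hxi)
      · exact inCard_union hlam hlim hδ hD hU fun i hi => (hP' i hi).2.2)
  have hDc : IncCont K.le (succ lam).ord D := ⟨hD1, hD2⟩
  obtain ⟨N, hN⟩ := exists_union hθ hDc
  have hDN : ∀ i < (succ lam).ord, K.le (D i) N := fun i hi => le_union hθ hDc hN hi
  have hMN : K.le M N := K.smooth _ A hθ hA.1 _ _ hA.2.2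
    fun i hi => K.le_trans (hD3 i hi hi).1 (hDN i hi)
  have hle : lam ≤ succ lam := Order.le_succ lam
  refine ⟨D, N, g, ⟨(K.le_mem hMN).2, hasCard_of_le hM.2 (subset_of_le hMN) ?_⟩, hMN,
    ⟨hDc, fun i hi => (hD3 i hi hi).2.2, hN⟩, hg, hgA, hD0,
    fun α hα => hD4 α (add_one_lt_ord_succ hlam hα)⟩
  refine hN.mk_le (hlam.trans hle) (by rw [Cardinal.card_ord]) fun i hi => ?_
  rw [(hD3 i hi hi).2.2.2]
  exact Cardinal.lift_le.2 hle

end NonForkingRelation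

/-! ### Realizing a non-forking type in a free extension -/

section Step

open AEC

variable {L : FirstOrder.Language.{u, u}} {lam : Cardinal.{u}}

/-- If `M ⪯ N` in `K_{λ⁺}`, there are filtrations of `M` and `N` such that each member of the former
is the intersection of `M` with the corresponding member of the latter. -/
theorem exists_filtration_inter {K : AEC L} (hlam : ℵ₀ ≤ lam) (hlst : K.lst ≤ lam) {M N : Model L}
    (hM : K.InCard (succ lam) M) (hN : K.InCard (succ lam) N) (hle : K.le M N) {x : ZFSet.{u}}
    (hx : x ∈ N.carrier) :
    ∃ A B : Ordinal.{u} → Model L, IsModelFiltration K lam A M ∧ IsModelFiltration K lam B N ∧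
      (∀ α < (succ lam).ord, (A α).carrier = (B α).carrier ∩ M.carrier) ∧ x ∈ (B 0).carrier := by
  obtain ⟨A, hA⟩ := exists_filtration hlam hlst hM
  obtain ⟨B, hB⟩ := exists_filtration hlam hlst hN
  obtain ⟨β₀, hβ₀, hxβ₀⟩ := hB.exists_mem hx
  obtain ⟨e, hen, helt, he⟩ := exists_isNormal_closed hlam
    (Q := fun β γ => (A β).carrier ⊆ (B γ).carrier ∧ (B β).carrier ∩ M.carrier ⊆ (A γ).carrier)
    (fun β β' γ hβ hβ' hQ => ⟨(hA.subset hβ hβ').trans hQ.1,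
      (Set.inter_subset_inter_left _ (hB.subset hβ hβ')).trans hQ.2⟩)
    (by
      intro β hβ
      obtain ⟨γ₁, hγ₁, h1⟩ := hB.exists_subset hlam (S := (A β).carrier)
        ((subset_of_le (hA.le hlam hβ)).trans (subset_of_le hle)) (hA.2.1 β hβ).2.le
      obtain ⟨γ₂, hγ₂, h2⟩ := hA.exists_subset hlam (S := (B β).carrier ∩ M.carrier)
        Set.inter_subset_right
        ((Cardinal.mk_le_mk_of_subset Set.inter_subset_left).trans (hB.2.1 β hβ).2.le)
      have hmax := max_lt hγ₁ hγ₂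
      exact ⟨_, hmax, h1.trans (hB.subset (le_max_left _ _) hmax),
        h2.trans (hA.subset (le_max_right _ _) hmax)⟩) hβ₀
  refine ⟨A ∘ e, B ∘ e, hA.comp_isNormal hlam hen helt, hB.comp_isNormal hlam hen helt, ?_, ?_⟩
  · intro α hα
    obtain ⟨-, hlim, hcl⟩ := he α hα
    apply subset_antisymm
    · intro y hy
      refine ⟨?_, subset_of_le (hA.le hlam (helt α hα)) hy⟩
      obtain ⟨β, hβ, hyβ⟩ := hA.exists_mem_of_limit (helt α hα) hlim hy
      obtain ⟨γ, hγ, hQ, -⟩ := hcl β hβ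
      exact hB.subset hγ.le (helt α hα) (hQ hyβ)
    · rintro y ⟨hy, hyM⟩
      obtain ⟨β, hβ, hyβ⟩ := hB.exists_mem_of_limit (helt α hα) hlim hy
      obtain ⟨γ, hγ, -, hQ⟩ := hcl β hβ
      exact hA.subset hγ.le (helt α hα) (hQ ⟨hyβ, hyM⟩)
  · have h0 : (0 : Ordinal.{u}) < (succ lam).ord := (isSuccLimit_ord_succ hlam).bot_lt
    exact hB.subset (he 0 h0).1 (helt 0 h0) hxβ₀

/-- If `M ≠ N`, some element of `N` outside `M` has a type over the members of a filtration of `M`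
that does not fork over the first member.

Basic types of elements of `B α` over `A α` exist by density, and for limit `α` such a type does not
fork over an earlier `A β`. If for each element and each `β` this happened for a bounded set of `α`
only, then an `α` closed under these bounds would give a contradiction. -/
theorem NonForkingFrame.IsSemiGood.exists_doesNotFork_filtration {s : NonForkingFrame L}
    (hs : s.IsSemiGood lam) {M N : Model L} (hM : s.K.InCard (succ lam) M)
    (hN : s.K.InCard (succ lam) N) (hle : s.K.le M N) (hne : M ≠ N) :
    ∃ (A : Ordinal.{u} → Model L) (B₀ : Model L) (a : ZFSet.{u}) (ha : a ∈ N.carrier),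
      IsModelFiltration s.K lam A M ∧ s.K.InCard lam B₀ ∧ s.K.le (A 0) B₀ ∧ s.K.le B₀ N ∧
      a ∈ B₀.carrier ∧ a ∉ M.carrier ∧ ∀ α < (succ lam).ord, ∀ h : s.K.le (A α) N,
        s.DoesNotFork (A 0) (tp h ⟨a, ha⟩) := by
  have hlam := hs.infinite
  have hsub := subset_of_le hle
  obtain ⟨x, hxN, hxM⟩ : ∃ x ∈ N.carrier, x ∉ M.carrier := by
    by_contra hcon
    push Not at hcon
    exact hne (eq_of_carrier hle (s.K.le_refl hN.1) (hsub.antisymm hcon))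
  obtain ⟨A, B, hA, hB, hAB, hx0⟩ := exists_filtration_inter hlam hs.lst_le hM hN hle hxN
  have hleN : ∀ α < (succ lam).ord, s.K.le (A α) N :=
    fun α hα => s.K.le_trans (hA.le hlam hα) hle
  have hleB : ∀ α < (succ lam).ord, s.K.le (A α) (B α) := fun α hα =>
    le_of_subset (hleN α hα) (hB.le hlam hα) (by rw [hAB α hα]; exact Set.inter_subset_left)
  -- `T a β α`: `a` lies outside `A α` and its type over `A α` does not fork over `A β`.
  let T : ZFSet.{u} → Ordinal.{u} → Ordinal.{u} → Prop := fun a β α =>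
    a ∉ (A α).carrier ∧ ∃ (h : s.K.le (A α) N) (ha : a ∈ N.carrier),
      s.DoesNotFork (A β) (tp h ⟨a, ha⟩)
  have hTmono : ∀ a β β' α, β ≤ β' → β' ≤ α → α < (succ lam).ord → T a β α → T a β' α := by
    rintro a β β' α hβ hβ' hα ⟨h1, h, ha, hd⟩
    exact ⟨h1, h, ha, hd.res hs (hA.1.mono _ _ hβ (hβ'.trans_lt hα)) (hA.1.mono _ _ hβ' hα)
      (s.K.le_refl (hA.2.1 α hα).1)⟩
  obtain ⟨β, hβ, a, haB, hunb⟩ : ∃ β < (succ lam).ord, ∃ a ∈ (B β).carrier,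
      ∀ γ < (succ lam).ord, ∃ α, γ ≤ α ∧ α < (succ lam).ord ∧ T a β α := by
    by_contra hcon
    push Not at hcon
    obtain ⟨e, hen, helt, he⟩ := exists_isNormal_closed hlam
      (Q := fun β γ => β ≤ γ ∧ ∀ a ∈ (B β).carrier, ∀ α, γ ≤ α → α < (succ lam).ord → ¬ T a β α)
      (fun β β' γ hββ' hβ' hQ => ⟨hββ'.trans hQ.1, fun a ha α hγα hα hT =>
        hQ.2 a (hB.subset hββ' hβ' ha) α hγα hα
          (hTmono a β β' α hββ' (hQ.1.trans hγα) hα hT)⟩)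
      (by
        intro β hβ
        obtain ⟨γ, hγ, h1⟩ := exists_bound hlam (hB.2.1 β hβ).2.le
          (P := fun a γ => ∀ α, γ ≤ α → α < (succ lam).ord → ¬ T a β α)
          (fun a _ γ γ' hγ _ h1 α hα => h1 α (hγ.trans hα)) (hcon β hβ)
        exact ⟨max β γ, max_lt hβ hγ, le_max_left _ _,
          fun a ha α hα => h1 a ha α ((le_max_right _ _).trans hα)⟩)
      (isSuccLimit_ord_succ hlam).bot_lt
    obtain ⟨-, hlim, hcl⟩ := he 0 (isSuccLimit_ord_succ hlam).bot_lt
    have hα := helt 0 (isSuccLimit_ord_succ hlam).bot_lt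
    set α := e 0
    have hneα : A α ≠ B α := by
      intro h1
      have h2 : x ∈ (A α).carrier := by
        rw [h1]
        exact hB.subset (zero_le (a := α)) hα hx0
      exact hxM (subset_of_le (hA.le hlam hα) h2)
    obtain ⟨a, haA, hbs⟩ := hs.density _ _ (hleB α hα) (hA.2.1 α hα) (hB.2.1 α hα) hneα
    have hα1 := add_one_lt_ord_succ hlam hα
    obtain ⟨β, hβ, hd⟩ := hs.exists_doesNotFork hlim hα (hA.1.mono_length hα1.le)
      (fun i hi => hA.2.1 i (hi.trans hα1)) (hB.2.1 α hα) (hleB α hα) a hbs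
    obtain ⟨γ, hγ, haγ⟩ := hB.exists_mem_of_limit hα hlim a.2
    have haN : (a : ZFSet.{u}) ∈ N.carrier := subset_of_le (hB.le hlam hα) a.2
    have hT : T a β α := by
      refine ⟨haA, hleN α hα, haN, ?_⟩
      rwa [← tp_eq_of_le (hleB α hα) (hleN α hα) (hB.le hlam hα) (a := a) (b := ⟨a, haN⟩) rfl]
    have hmax := max_lt hβ hγ
    obtain ⟨γ', hγ', -, hQ⟩ := hcl _ hmax
    exact hQ a (hB.subset (le_max_right _ _) (hmax.trans hα) haγ) α hγ'.le hα
      (hTmono a β _ α (le_max_left _ _) hmax.le hα hT)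
  have haN : a ∈ N.carrier := subset_of_le (hB.le hlam hβ) haB
  have hn := Ordinal.isNormal_add_right β
  have hlt : ∀ α < (succ lam).ord, β + α < (succ lam).ord := fun α hα =>
    Ordinal.isPrincipal_add_ord (hlam.trans (Order.le_succ lam)) hβ hα
  refine ⟨A ∘ (β + ·), B β, a, haN, hA.comp_isNormal hlam hn hlt, hB.2.1 β hβ, ?_,
    hB.le hlam hβ, haB, fun haM => ?_, fun α hα h => ?_⟩
  · simpa using hleB β hβ
  · obtain ⟨γ, hγ, haγ⟩ := hA.exists_mem haM
    obtain ⟨α, hγα, hα, hT, -⟩ := hunb γ hγ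
    exact hT (hA.subset hγα hα haγ)
  · obtain ⟨α', hαα', hα', -, h', _, hd⟩ := hunb _ (hlt α hα)
    have h1 := hd.res hs (s.K.le_refl (hA.2.1 β hβ).1)
      (hA.1.mono β (β + α) le_self_add (hlt α hα)) (hA.1.mono _ _ hαα' hα')
    rw [Function.comp, add_zero]
    exact h1

/-- The step of the construction: if `N ⪯ N'` in `K_{λ⁺}`, then `N` has a `LeNF`-extension inside an
extension of `N'`, which captures a new element of `N'` if there is one.

An element `a` of `N'` as in `IsSemiGood.exists_doesNotFork_filtration` has a conjugate `b` in a
free extension `D` of `N`. As the relation respects the frame, the types of `a` and `b` over each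
member of the filtration do not fork over the first, so they agree by uniqueness; the types over `N`
agree by tameness. -/
theorem exists_leNF_step {s : NonForkingFrame L} (hs : s.IsSemiGood lam)
    (hAP : s.K.Amalgamation (succ lam)) (hTame : s.K.Tame lam (succ lam))
    {NF : Model L → Model L → Model L → Model L → Prop} (hNF : IsNonForkingRelation s.K lam NF)
    (hResp : RespectsFrame s NF) {N N' : Model L} (hN : s.K.InCard (succ lam) N)
    (hN' : s.K.InCard (succ lam) N') (hle : s.K.le N N') :
    ∃ P P' : Model L, s.K.InCard (succ lam) P' ∧ LeNF s.K lam NF N P ∧ s.K.le P P' ∧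
      s.K.le N' P' ∧ (N ≠ N' → ∃ a ∈ N'.carrier, a ∈ P.carrier ∧ a ∉ N.carrier) := by
  have hlam := hs.infinite
  by_cases hne : N = N'
  · exact ⟨N, N', hN', LeNF.refl hNF hlam hs.lst_le hN, hle, s.K.le_refl hN'.1,
      fun h => absurd hne h⟩
  obtain ⟨A, B₀, a, ha, hA, hB₀, hAB, hBN, haB, haN, hd⟩ :=
    hs.exists_doesNotFork_filtration hN hN' hle hne
  obtain ⟨D, E, g, hE, hNE, hD, hg, hgA, hD0, hDNF⟩ := exists_leNF_of_le hNF hlam hN hA hB₀ hAB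
  have h0 : (0 : Ordinal.{u}) < (succ lam).ord := (isSuccLimit_ord_succ hlam).bot_lt
  have hAN' : ∀ α < (succ lam).ord, s.K.le (A α) N' :=
    fun α hα => s.K.le_trans (hA.le hlam hα) hle
  have hAE : ∀ α < (succ lam).ord, s.K.le (A α) E :=
    fun α hα => s.K.le_trans (hA.le hlam hα) hNE
  have hDE0 := hD.le hlam h0
  have hgE : s.K.IsEmb g B₀ E := by
    refine ⟨hg, ?_⟩
    rw [← hD0]
    exact hDE0
  have hbD : g a ∈ (D 0).carrier := by
    rw [hD0, carrier_map hg]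
    exact ⟨a, haB, rfl⟩
  have hbE : g a ∈ E.carrier := hgE.apply_mem haB
  -- The two types over the first member of the filtration agree.
  have htp0 : tp (hAN' 0 h0) ⟨a, ha⟩ = tp (hAE 0 h0) ⟨g a, hbE⟩ := by
    rw [← tp_eq_of_le hAB (hAN' 0 h0) hBN (a := ⟨a, haB⟩) (b := ⟨a, ha⟩) rfl]
    exact tp_eq_of_isEmb hAB (hAE 0 h0) hgE hgA rfl
  have hAD : s.K.le (A 0) (D 0) := (hNF.disjoint _ _ _ _ (hDNF 0 h0)).1
  have hbs : tp hAD ⟨g a, hbD⟩ ∈ s.bs (A 0) := by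
    rw [tp_eq_of_le hAD (hAE 0 h0) hDE0 (b := ⟨g a, hbE⟩) rfl, ← htp0]
    exact (hd 0 h0 _).mem_bs hs
  have hbA : g a ∉ (A 0).carrier := by
    intro h1
    have h2 : g a = g (g a) := (hgA _ h1).symm
    have h3 := hg haB (subset_of_le hAB h1) h2
    rw [← h3] at h1
    exact haN (subset_of_le (hA.le hlam h0) h1)
  have htp : ∀ α (hα : α < (succ lam).ord),
      tp (hAN' α hα) ⟨a, ha⟩ = tp (hAE α hα) ⟨g a, hbE⟩ := by
    intro α hα
    rcases (zero_le (a := α)).eq_or_lt with rfl | hα0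
    · exact htp0
    have hNFα := hNF.of_lt hA hD hDNF hα0 hα
    obtain ⟨-, hDD, hAA, hADα, -⟩ := hNF.disjoint _ _ _ _ hNFα
    have h1 := hResp _ _ _ _ hAD hADα ⟨g a, hbD⟩ ⟨g a, subset_of_le hDD hbD⟩ hNFα rfl hbA hbs
    rw [tp_eq_of_le hADα (hAE α hα) (hD.le hlam hα) (b := ⟨g a, hbE⟩) rfl] at h1
    have h2 := hd α hα (hAN' α hα)
    exact hs.uniqueness _ _ hAA (hA.2.1 0 h0) (hA.2.1 α hα) _ (h2.mem_bs hs) _ (h1.mem_bs hs) h2 h1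
      htp0
  have htpN : tp hle ⟨a, ha⟩ = tp hNE ⟨g a, hbE⟩ := by
    refine hTame N hN _ _ fun X hX hXc => ?_
    obtain ⟨α, hα, hXα⟩ := hA.exists_subset hlam (subset_of_le hX) hXc.2.le
    have hXA : s.K.le X (A α) := le_of_subset hX (hA.le hlam hα) hXα
    exact congrArg (GType.res hXA) (htp α hα)
  obtain ⟨P, k, hP, hN'P, hk, hkN, hka⟩ := exists_le_of_tp_eq hlam hs.lst_le (Order.le_succ lam)
    hAP hle hNE hN hN' hE htpN
  have hLe : LeNF s.K lam NF N E := (leNF_iff hlam hN hE hNE).2 ⟨A, D, hA, hD, hDNF⟩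
  refine ⟨E.map k, P, hP, hLe.map hNF hlam hk.1 hkN, hk.2, hN'P, fun _ => ⟨a, ha, ?_, haN⟩⟩
  rw [carrier_map hk.1]
  exact ⟨g a, hbE, hka⟩

end Step

/-! ### Unions of chains of free extensions -/

section Chain

open AEC

variable {L : FirstOrder.Language.{u, u}} {K : AEC L} {lam : Cardinal.{u}}

/-- The traces of a fixed set on the members of a continuous chain form a continuous chain. -/
theorem incCont_of_inter {N X : Ordinal.{u} → Model L} {S : Set ZFSet.{u}} {ε : Ordinal.{u}}
    (hN : IncCont K.le ε N) (hX : ∀ i < ε, K.le (X i) (N i) ∧ (X i).carrier = S ∩ (N i).carrier) :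
    IncCont K.le ε X := by
  have hmono : ∀ i j, i ≤ j → j < ε → K.le (X i) (X j) := by
    intro i j hij hj
    have hi := hij.trans_lt hj
    refine le_of_subset (K.le_trans (hX i hi).1 (hN.mono i j hij hj)) (hX j hj).1 ?_
    rw [(hX i hi).2, (hX j hj).2]
    exact Set.inter_subset_inter_right _ (subset_of_le (hN.mono i j hij hj))
  refine ⟨hmono, fun j hj hlim => ⟨?_, fun i hi => K.sub (hmono i j hi.le hj)⟩⟩
  rw [(hX j hj).2, (hN.cont j hj hlim).1]
  ext x
  constructor
  · rintro ⟨hxS, i, hi, hx⟩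
    exact ⟨i, hi, (hX i (hi.trans hj)).2.symm.subset ⟨hxS, hx⟩⟩
  · rintro ⟨i, hi, hx⟩
    have h1 := (hX i (hi.trans hj)).2.subset hx
    exact ⟨h1.1, i, hi, h1.2⟩

/-- Let `M'` lie between the first and the last member of a continuous chain in `K_{λ⁺}` whose
successive members are `LeNF`-related. Then `M'` is a `LeNF`-extension of the first member.

Let `S` run through a suitable filtration `C` of the last member `N δ`. The traces `S ∩ N j` form
a continuous chain, and if some element of `S` appears first in `N (j + 1)`, then `S ∩ N j` and
`S ∩ N (j + 1)` are members with the same index of the two filtrations that witness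
`LeNF (N j) (N (j + 1))`; for other `j` these two traces coincide. So two such sets `S` give chains
of traces to which long transitivity applies, even though the chains may be longer than `λ`. -/
theorem leNF_of_chain {NF : Model L → Model L → Model L → Model L → Prop}
    (h : IsNonForkingRelation K lam NF) (hlam : ℵ₀ ≤ lam) (hlst : K.lst ≤ lam) {δ : Ordinal.{u}}
    (hδ : 0 < δ) {N : Ordinal.{u} → Model L} (hN : IncCont K.le (δ + 1) N)
    (hc : ∀ i < δ + 1, K.InCard (succ lam) (N i)) (hstep : ∀ i < δ, LeNF K lam NF (N i) (N (i + 1)))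
    {M' : Model L} (hM' : K.InCard (succ lam) M') (hM0 : K.le (N 0) M') (hMδ : K.le M' (N δ)) :
    LeNF K lam NF (N 0) M' := by
  have hθ := isSuccLimit_ord_succ hlam
  have : Nonempty (Model L) := ⟨M'⟩
  have hlt1 : ∀ {i}, i ≤ δ → i < δ + 1 := fun hi => Order.lt_add_one_iff.2 hi
  have hadd : ∀ {i}, i < δ → i + 1 ≤ δ := fun hi => Order.add_one_le_of_lt hi
  have hNsub : ∀ {i j}, i ≤ j → j ≤ δ → (N i).carrier ⊆ (N j).carrier :=
    fun hij hj => subset_of_le (hN.mono _ _ hij (hlt1 hj))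
  have hfil : ∀ j, j < δ → ∃ A B : Ordinal.{u} → Model L, IsModelFiltration K lam A (N j) ∧
      IsModelFiltration K lam B (N (j + 1)) ∧
      ∀ α < (succ lam).ord, NF (A α) (B α) (A (α + 1)) (B (α + 1)) := fun j hj =>
    (leNF_iff hlam (hstep j hj).1 (hstep j hj).2.1 (hstep j hj).2.2.1).1 (hstep j hj)
  choose! A B hA hB hAB using hfil
  obtain ⟨C, hC⟩ := exists_filtration hlam hlst (hc δ (hlt1 le_rfl))
  obtain ⟨C', hC'⟩ := exists_filtration hlam hlst hM'
  have hCsub : ∀ α < (succ lam).ord, (C α).carrier ⊆ (N δ).carrier :=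
    fun α hα => subset_of_le (hC.le hlam hα)
  -- `ρ x` is the least `j` with `x ∈ N (j + 1)`.
  let ρ : ZFSet.{u} → Ordinal.{u} := fun x => sInf {j | x ∈ (N (j + 1)).carrier}
  have hex : ∀ k, k ≤ δ → ∀ x ∈ (N k).carrier, ∃ j < δ, x ∈ (N (j + 1)).carrier := by
    intro k
    induction k using Ordinal.limitRecOn with
    | zero => exact fun _ x hx => ⟨0, hδ, hNsub (zero_le (a := 0 + 1)) (hadd hδ) hx⟩
    | add_one k _ => exact fun hk x hx => ⟨k, (lt_add_one k).trans_le hk, hx⟩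
    | limit k hk ih =>
      intro hkδ x hx
      obtain ⟨i, hi, hxi⟩ := (hN.cont k (hlt1 hkδ) hk).1.subset hx
      exact ih i hi (hi.le.trans hkδ) x hxi
  have hρ : ∀ x ∈ (N δ).carrier, ρ x < δ ∧ x ∈ (N (ρ x + 1)).carrier := by
    intro x hx
    obtain ⟨j, hj, hxj⟩ := hex δ le_rfl x hx
    exact ⟨(csInf_le' (s := {j | x ∈ (N (j + 1)).carrier}) hxj).trans_lt hj,
      csInf_mem (s := {j | x ∈ (N (j + 1)).carrier}) ⟨j, hxj⟩⟩
  have hρ' : ∀ x j, j < δ → x ∈ (N (j + 1)).carrier → x ∉ (N j).carrier → ρ x = j := by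
    intro x j hj hx hxj
    have hle : ρ x ≤ j := csInf_le' hx
    rcases hle.lt_or_eq with hlt | heq
    · exact absurd (hNsub (Order.add_one_le_of_lt hlt) hj.le
        (hρ x (hNsub (hadd hj) le_rfl hx)).2) hxj
    · exact heq
  -- `J β` is the set of indices `j` that are visible in `C β`.
  let J : Ordinal.{u} → Set Ordinal.{u} := fun β => {j | j = 0 ∨ ∃ y ∈ (C β).carrier, ρ y = j}
  have hJmono : ∀ {β β'}, β ≤ β' → β' < (succ lam).ord → J β ⊆ J β' := by
    rintro β β' hβ hβ' j (h1 | ⟨y, hy, h1⟩)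
    · exact Or.inl h1
    · exact Or.inr ⟨y, hC.subset hβ hβ' hy, h1⟩
  have hJδ : ∀ {β}, β < (succ lam).ord → ∀ j ∈ J β, j < δ := by
    rintro β hβ j (rfl | ⟨y, hy, rfl⟩)
    · exact hδ
    · exact (hρ y (hCsub β hβ hy)).1
  let R : Ordinal.{u} → Ordinal.{u} → Ordinal.{u} → Prop := fun β j γ =>
    (C β).carrier ∩ (N (j + 1)).carrier ⊆ (B j γ).carrier ∧ (B j β).carrier ⊆ (C γ).carrier
  have hRmono : ∀ {β j γ γ'}, j < δ → γ ≤ γ' → γ' < (succ lam).ord → R β j γ → R β j γ' :=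
    fun hj hγ hγ' hR => ⟨hR.1.trans ((hB _ hj).subset hγ hγ'), hR.2.trans (hC.subset hγ hγ')⟩
  have hRex : ∀ β < (succ lam).ord, ∀ j < δ, ∃ γ < (succ lam).ord, R β j γ := by
    intro β hβ j hj
    obtain ⟨γ₁, hγ₁, h1⟩ := (hB j hj).exists_subset hlam
      (S := (C β).carrier ∩ (N (j + 1)).carrier) Set.inter_subset_right
      ((Cardinal.mk_le_mk_of_subset Set.inter_subset_left).trans (hC.2.1 β hβ).2.le)
    obtain ⟨γ₂, hγ₂, h2⟩ := hC.exists_subset hlam (S := (B j β).carrier)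
      ((subset_of_le ((hB j hj).le hlam hβ)).trans (hNsub (hadd hj) le_rfl))
      ((hB j hj).2.1 β hβ).2.le
    have hmax := max_lt hγ₁ hγ₂
    exact ⟨_, hmax, h1.trans ((hB j hj).subset (le_max_left _ _) hmax),
      h2.trans (hC.subset (le_max_right _ _) hmax)⟩
  obtain ⟨e, hen, helt, he⟩ := exists_isNormal_closed hlam
    (Q := fun β γ => (∀ j ∈ J β, R β j γ) ∧ (C β).carrier ∩ M'.carrier ⊆ (C' γ).carrier ∧
      (C' β).carrier ⊆ (C γ).carrier)
    (by
      rintro β β' γ hβ hβ' ⟨h1, h2, h3⟩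
      refine ⟨fun j hj => ?_, (Set.inter_subset_inter_left _ (hC.subset hβ hβ')).trans h2,
        (hC'.subset hβ hβ').trans h3⟩
      have hjδ := hJδ (hβ.trans_lt hβ') j hj
      have h4 := h1 j (hJmono hβ hβ' hj)
      exact ⟨(Set.inter_subset_inter_left _ (hC.subset hβ hβ')).trans h4.1,
        ((hB j hjδ).subset hβ hβ').trans h4.2⟩)
    (by
      intro β hβ
      obtain ⟨γ₀, hγ₀, h0⟩ := hRex β hβ 0 hδ
      obtain ⟨γ₁, hγ₁, h1⟩ := exists_bound hlam (hC.2.1 β hβ).2.le (P := fun y γ => R β (ρ y) γ)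
        (fun y hy γ γ' hγ hγ' hR => hRmono (hρ y (hCsub β hβ hy)).1 hγ hγ' hR)
        (fun y hy => hRex β hβ _ (hρ y (hCsub β hβ hy)).1)
      obtain ⟨γ₂, hγ₂, h2⟩ := hC'.exists_subset hlam (S := (C β).carrier ∩ M'.carrier)
        Set.inter_subset_right
        ((Cardinal.mk_le_mk_of_subset Set.inter_subset_left).trans (hC.2.1 β hβ).2.le)
      obtain ⟨γ₃, hγ₃, h3⟩ := hC.exists_subset hlam (S := (C' β).carrier)
        ((subset_of_le (hC'.le hlam hβ)).trans (subset_of_le hMδ)) (hC'.2.1 β hβ).2.le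
      have hmax := max_lt (max_lt hγ₀ hγ₁) (max_lt hγ₂ hγ₃)
      refine ⟨_, hmax, ?_, h2.trans (hC'.subset ((le_max_left _ _).trans (le_max_right _ _)) hmax),
        h3.trans (hC.subset ((le_max_right _ _).trans (le_max_right _ _)) hmax)⟩
      rintro j (rfl | ⟨y, hy, rfl⟩)
      · exact hRmono hδ ((le_max_left _ _).trans (le_max_left _ _)) hmax h0
      · exact hRmono (hρ y (hCsub β hβ hy)).1 ((le_max_right _ _).trans (le_max_left _ _)) hmax
          (h1 y hy)) hθ.bot_lt
  -- At closed points, the filtrations are the traces of `C`.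
  have hJlim : ∀ α < (succ lam).ord, ∀ j ∈ J (e α), ∃ β < e α, j ∈ J β := by
    rintro α hα j (hj | ⟨y, hy, hj⟩)
    · exact ⟨0, (he α hα).2.1.bot_lt, Or.inl hj⟩
    · obtain ⟨β, hβ, hyβ⟩ := hC.exists_mem_of_limit (helt α hα) (he α hα).2.1 hy
      exact ⟨β, hβ, Or.inr ⟨y, hyβ, hj⟩⟩
  have hBC : ∀ α < (succ lam).ord, ∀ j ∈ J (e α),
      (B j (e α)).carrier = (C (e α)).carrier ∩ (N (j + 1)).carrier := by
    intro α hα j hj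
    have hjδ := hJδ (helt α hα) j hj
    obtain ⟨β, hβ, hjβ⟩ := hJlim α hα j hj
    obtain ⟨-, hlim, hcl⟩ := he α hα
    apply subset_antisymm
    · intro x hx
      refine ⟨?_, subset_of_le ((hB j hjδ).le hlam (helt α hα)) hx⟩
      obtain ⟨β', hβ', hxβ'⟩ := (hB j hjδ).exists_mem_of_limit (helt α hα) hlim hx
      have hmax := max_lt hβ hβ'
      obtain ⟨γ, hγ, hQ, -⟩ := hcl _ hmax
      exact hC.subset hγ.le (helt α hα) ((hQ j (hJmono (le_max_left _ _)
        (hmax.trans (helt α hα)) hjβ)).2 ((hB j hjδ).subset (le_max_right _ _)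
          (hmax.trans (helt α hα)) hxβ'))
    · rintro x ⟨hx, hxN⟩
      obtain ⟨β', hβ', hxβ'⟩ := hC.exists_mem_of_limit (helt α hα) hlim hx
      have hmax := max_lt hβ hβ'
      obtain ⟨γ, hγ, hQ, -⟩ := hcl _ hmax
      exact (hB j hjδ).subset hγ.le (helt α hα) ((hQ j (hJmono (le_max_left _ _)
        (hmax.trans (helt α hα)) hjβ)).1 ⟨hC.subset (le_max_right _ _)
          (hmax.trans (helt α hα)) hxβ', hxN⟩)
  have hCC' : ∀ α < (succ lam).ord,
      (C' (e α)).carrier = (C (e α)).carrier ∩ M'.carrier := by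
    intro α hα
    obtain ⟨-, hlim, hcl⟩ := he α hα
    apply subset_antisymm
    · intro x hx
      refine ⟨?_, subset_of_le (hC'.le hlam (helt α hα)) hx⟩
      obtain ⟨β, hβ, hxβ⟩ := hC'.exists_mem_of_limit (helt α hα) hlim hx
      obtain ⟨γ, hγ, -, -, hQ⟩ := hcl β hβ
      exact hC.subset hγ.le (helt α hα) (hQ hxβ)
    · rintro x ⟨hx, hxM⟩
      obtain ⟨β, hβ, hxβ⟩ := hC.exists_mem_of_limit (helt α hα) hlim hx
      obtain ⟨γ, hγ, -, hQ, -⟩ := hcl β hβ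
      exact hC'.subset hγ.le (helt α hα) (hQ ⟨hxβ, hxM⟩)
  have hABN : ∀ j < δ, ∀ α < (succ lam).ord,
      (A j α).carrier = (B j α).carrier ∩ (N j).carrier := by
    intro j hj α hα
    apply subset_antisymm
    · exact Set.subset_inter (subset_of_le (h.disjoint _ _ _ _ (hAB j hj α hα)).1)
        (subset_of_le ((hA j hj).le hlam hα))
    · rintro x ⟨hxB, hxN⟩
      obtain ⟨γ, hγ, hxγ⟩ := (hA j hj).exists_mem hxN
      have hmax := max_lt (add_one_lt_ord_succ hlam hα) hγ
      have h1 := h.of_lt (hA j hj) (hB j hj) (hAB j hj)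
        ((lt_add_one α).trans_le (le_max_left (α + 1) γ)) hmax
      exact (h.disjoint _ _ _ _ h1).2.2.2.2.subset
        ⟨hxB, (hA j hj).subset (le_max_right _ _) hmax hxγ⟩
  have hAC : ∀ α < (succ lam).ord, ∀ j ∈ J (e α),
      (A j (e α)).carrier = (C (e α)).carrier ∩ (N j).carrier := by
    intro α hα j hj
    have hjδ := hJδ (helt α hα) j hj
    rw [hABN j hjδ _ (helt α hα), hBC α hα j hj, Set.inter_assoc,
      Set.inter_eq_right.2 (hNsub (lt_add_one j).le (hadd hjδ))]
  have hstat : ∀ α < (succ lam).ord, ∀ j < δ, j ∉ J (e α) →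
      (C (e α)).carrier ∩ (N (j + 1)).carrier = (C (e α)).carrier ∩ (N j).carrier := by
    intro α hα j hj hjJ
    apply subset_antisymm
    · rintro x ⟨hxC, hxN⟩
      refine ⟨hxC, ?_⟩
      by_contra hxj
      exact hjJ (Or.inr ⟨x, hxC, hρ' x j hj hxN hxj⟩)
    · exact Set.inter_subset_inter_right _ (hNsub (lt_add_one j).le (hadd hj))
  have hE : ∀ α j, α < (succ lam).ord → j ≤ δ →
      ∃ X, K.le X (N j) ∧ X.carrier = (C (e α)).carrier ∩ (N j).carrier := by
    intro α j hα
    induction j using Ordinal.limitRecOn with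
    | zero =>
      exact fun _ => ⟨A 0 (e α), (hA 0 hδ).le hlam (helt α hα), hAC α hα 0 (Or.inl rfl)⟩
    | add_one j ih =>
      intro hj
      have hjδ := (lt_add_one j).trans_le hj
      by_cases hjJ : j ∈ J (e α)
      · exact ⟨B j (e α), (hB j hjδ).le hlam (helt α hα), hBC α hα j hjJ⟩
      · obtain ⟨X, hX, hXc⟩ := ih hjδ.le
        exact ⟨X, K.le_trans hX (hN.mono _ _ (lt_add_one j).le (hlt1 hj)),
          hXc.trans (hstat α hα j hjδ hjJ).symm⟩
    | limit j hj ih =>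
      intro hjδ
      have ih' : ∀ i, i < j →
          ∃ X, K.le X (N i) ∧ X.carrier = (C (e α)).carrier ∩ (N i).carrier :=
        fun i hi => ih i hi (hi.le.trans hjδ)
      choose! X hX using ih'
      have hXinc := incCont_of_inter (hN.mono_length (hjδ.trans (lt_add_one δ).le)) hX
      obtain ⟨U, hU⟩ := exists_union hj hXinc
      refine ⟨U, K.smooth j X hj hXinc U _ hU fun i hi =>
        K.le_trans (hX i hi).1 (hN.mono _ _ hi.le (hlt1 hjδ)), ?_⟩
      rw [hU.1, (hN.cont j (hlt1 hjδ) hj).1]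
      ext x
      constructor
      · rintro ⟨i, hi, hx⟩
        have h1 := (hX i hi).2.subset hx
        exact ⟨h1.1, i, hi, h1.2⟩
      · rintro ⟨hxC, i, hi, hx⟩
        exact ⟨i, hi, (hX i hi).2.symm.subset ⟨hxC, hx⟩⟩
  choose! E hEle hEc using hE
  have hEA : ∀ α < (succ lam).ord, ∀ j ∈ J (e α), E α j = A j (e α) := fun α hα j hj =>
    have hjδ := hJδ (helt α hα) j hj
    eq_of_carrier (hEle α j hα hjδ.le) ((hA j hjδ).le hlam (helt α hα))
      ((hEc α j hα hjδ.le).trans (hAC α hα j hj).symm)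
  have hEB : ∀ α < (succ lam).ord, ∀ j ∈ J (e α), E α (j + 1) = B j (e α) := fun α hα j hj =>
    have hjδ := hJδ (helt α hα) j hj
    eq_of_carrier (hEle α _ hα (hadd hjδ)) ((hB j hjδ).le hlam (helt α hα))
      ((hEc α _ hα (hadd hjδ)).trans (hBC α hα j hj).symm)
  have hEinc : ∀ α < (succ lam).ord, IncCont K.le (δ + 1) (E α) := fun α hα =>
    incCont_of_inter hN fun i hi =>
      ⟨hEle α i hα (Order.lt_add_one_iff.1 hi), hEc α i hα (Order.lt_add_one_iff.1 hi)⟩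
  have hEcard : ∀ α < (succ lam).ord, ∀ i < δ + 1, K.InCard lam (E α i) := by
    intro α hα i hi
    have h1 := (hEinc α hα).mono 0 i (zero_le (a := i)) hi
    rw [hEA α hα 0 (Or.inl rfl)] at h1
    refine ⟨(K.le_mem h1).2, hasCard_of_le ((hA 0 hδ).2.1 _ (helt α hα)).2 (subset_of_le h1) ?_⟩
    rw [hEc α i hα (Order.lt_add_one_iff.1 hi), ← (hC.2.1 _ (helt α hα)).2]
    exact Cardinal.mk_le_mk_of_subset Set.inter_subset_left
  have hEE : ∀ α β, α < β → β < (succ lam).ord → NF (E α 0) (E α δ) (E β 0) (E β δ) := by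
    intro α β hαβ hβ
    have hα := hαβ.trans hβ
    have heαβ := hen.strictMono hαβ
    refine h.long_transitivity δ (E α) (E β) hδ (hEinc α hα) (hEinc β hβ)
      (fun i hi => ⟨hEcard α hα i hi, hEcard β hβ i hi⟩) fun i hi => ?_
    have hi1 := hlt1 hi.le
    have hi2 := hlt1 (hadd hi)
    by_cases hiJ : i ∈ J (e α)
    · have hiJ' := hJmono heαβ.le (helt β hβ) hiJ
      rw [hEA α hα i hiJ, hEB α hα i hiJ, hEA β hβ i hiJ', hEB β hβ i hiJ']
      exact h.of_lt (hA i hi) (hB i hi) (hAB i hi) heαβ (helt β hβ)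
    · have h1 : E α (i + 1) = E α i := by
        refine (eq_of_carrier (K.le_trans (hEle α i hα hi.le) (hN.mono _ _ (lt_add_one i).le hi2))
          (hEle α _ hα (hadd hi)) ?_).symm
        rw [hEc α i hα hi.le, hEc α _ hα (hadd hi), hstat α hα i hi hiJ]
      rw [h1]
      refine h.refl_left (hEcard α hα i hi1) (hEcard β hβ i hi1) (hEcard β hβ _ hi2)
        (le_of_subset (hEle α i hα hi.le) (hEle β i hβ hi.le) ?_)
        ((hEinc β hβ).mono _ _ (lt_add_one i).le hi2)
      rw [hEc α i hα hi.le, hEc β i hβ hi.le]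
      exact Set.inter_subset_inter_left _ (hC.subset heαβ.le (helt β hβ))
  -- Finally, the traces on `N δ` are cut down to `M'`.
  have hE0 : ∀ α < (succ lam).ord, K.le (E α 0) (C' (e α)) := by
    intro α hα
    refine le_of_subset (K.le_trans (hEle α 0 hα hδ.le) hM0) (hC'.le hlam (helt α hα)) ?_
    rw [hEc α 0 hα hδ.le, hCC' α hα]
    exact Set.inter_subset_inter_right _ (subset_of_le hM0)
  have hEδ : ∀ α < (succ lam).ord, K.le (C' (e α)) (E α δ) := by
    intro α hα
    refine le_of_subset (K.le_trans (hC'.le hlam (helt α hα)) hMδ) (hEle α δ hα le_rfl) ?_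
    rw [hEc α δ hα le_rfl, hCC' α hα]
    exact Set.inter_subset_inter_right _ (subset_of_le hMδ)
  have hC'' := hC'.comp_isNormal hlam hen helt
  rw [leNF_iff hlam (hc 0 (hlt1 hδ.le)) hM' hM0]
  refine ⟨A 0 ∘ e, C' ∘ e, (hA 0 hδ).comp_isNormal hlam hen helt, hC'', fun α hα => ?_⟩
  have hα' := add_one_lt_ord_succ hlam hα
  have h1 := hEE α (α + 1) (lt_add_one α) hα'
  simp only [Function.comp]
  rw [← hEA α hα 0 (Or.inl rfl), ← hEA _ hα' 0 (Or.inl rfl)]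
  exact h.monotonicity _ _ _ _ _ _ _ _ h1 (hEδ α hα)
    (K.le_refl (hEcard _ hα' 0 (hlt1 hδ.le)).1) (hE0 α hα)
    (h.disjoint _ _ _ _ h1).2.2.1 (hC''.1.mono _ _ (lt_add_one α).le hα') (hE0 _ hα')
    (hC''.2.1 _ hα') (K.le_refl (hEcard _ hα' δ (hlt1 le_rfl)).1) (hEδ _ hα')

end Chain

/-! ### Capturing an arbitrary extension -/

theorem mainTheorem2 {L : FirstOrder.Language.{u, u}} (lam : Cardinal.{u}) (s : NonForkingFrame L)
    (hs : s.IsSemiGood lam)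
    (hAP : s.K.Amalgamation (Order.succ lam))
    (hTame : s.K.Tame lam (Order.succ lam))
    (NF : Model L → Model L → Model L → Model L → Prop)
    (hNF : IsNonForkingRelation s.K lam NF)
    (hResp : RespectsFrame s NF)
    (M M' : Model L) (hM : s.K.InCard (Order.succ lam) M) (hM' : s.K.InCard (Order.succ lam) M') :
    s.K.le M M' ↔ LeNF s.K lam NF M M' := by
  refine ⟨fun hle => ?_, fun h => h.2.2.1⟩
  have hlam := hs.infinite
  have hμ : ℵ₀ ≤ succ lam := hlam.trans (Order.le_succ lam)
  have hθ := isSuccLimit_ord_succ hμ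
  -- A chain of pairs `N ⪯ N'` of length `λ⁺⁺`; each step adds to `N` an element of `N' \ N`.
  obtain ⟨X, hX0, hXmono, hXcont, hXP, hXstep⟩ := exists_chain (T := Model L × Model L)
    (succ (succ lam)).ord (fun Y Z => s.K.le Y.1 Z.1 ∧ s.K.le Y.2 Z.2)
    (fun δ Y U => IsUnion δ (fun i => (Y i).1) U.1 ∧ IsUnion δ (fun i => (Y i).2) U.2)
    (fun _ Y => s.K.InCard (succ lam) Y.1 ∧ s.K.InCard (succ lam) Y.2 ∧ s.K.le Y.1 Y.2)
    (fun _ Y Z => LeNF s.K lam NF Y.1 Z.1 ∧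
      (Y.1 ≠ Y.2 → ∃ a ∈ Y.2.carrier, a ∈ Z.1.carrier ∧ a ∉ Y.1.carrier))
    (M, M') ⟨hM, hM', hle⟩
    (fun _ _ Y hY => ⟨s.K.le_refl hY.1.1, s.K.le_refl hY.2.1.1⟩)
    (fun _ _ _ h h' => ⟨s.K.le_trans h.1 h'.1, s.K.le_trans h.2 h'.2⟩)
    (fun _ _ _ _ h hU => ⟨hU.1.congr fun i hi => congrArg Prod.fst (h i hi),
      hU.2.congr fun i hi => congrArg Prod.snd (h i hi)⟩)
    (by
      rintro i - Y ⟨hY1, hY2, hY⟩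
      obtain ⟨P, P', hP', h1, h2, h3, h4⟩ := exists_leNF_step hs hAP hTame hNF hResp hY1 hY2 hY
      exact ⟨(P, P'), ⟨h1.2.1, hP', h2⟩, ⟨h1.2.2.1, h3⟩, h1, h4⟩)
    (by
      intro δ hδ hlim Y hmono hcont hP
      have hY1 : IncCont s.K.le δ (fun i => (Y i).1) :=
        ⟨fun i j hij hj => (hmono i j hij hj).1, fun j hj hl => (hcont j hj hl).1⟩
      have hY2 : IncCont s.K.le δ (fun i => (Y i).2) :=
        ⟨fun i j hij hj => (hmono i j hij hj).2, fun j hj hl => (hcont j hj hl).2⟩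
      obtain ⟨U, hU⟩ := AEC.exists_union hlim hY1
      obtain ⟨V, hV⟩ := AEC.exists_union hlim hY2
      exact ⟨(U, V), ⟨hU, hV⟩, ⟨AEC.inCard_union hμ hlim hδ hY1 hU fun i hi => (hP i hi).1,
        AEC.inCard_union hμ hlim hδ hY2 hV fun i hi => (hP i hi).2.1,
        s.K.smooth δ _ hlim hY1 U V hU fun i hi =>
          s.K.le_trans (hP i hi).2.2 (AEC.le_union hlim hY2 hV hi)⟩,
        fun i hi => ⟨AEC.le_union hlim hY1 hU hi, AEC.le_union hlim hY2 hV hi⟩⟩)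
  -- At a limit stage that is closed under the stages at which elements are captured, the two
  -- models of the pair coincide.
  obtain ⟨e, -, helt, he⟩ := exists_isNormal_closed hμ
    (Q := fun β γ => ∀ x ∈ (X β).2.carrier,
      (∃ i < (succ (succ lam)).ord, x ∈ (X i).1.carrier) → x ∈ (X γ).1.carrier)
    (fun β β' γ hβ hβ' hQ x hx => hQ x (AEC.subset_of_le (hXmono β β' hβ hβ').2 hx))
    (fun β hβ => exists_bound hμ (hXP β hβ).2.1.2.le
      (P := fun x γ => (∃ i < (succ (succ lam)).ord, x ∈ (X i).1.carrier) → x ∈ (X γ).1.carrier)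
      (fun x _ γ γ' hγ hγ' h1 h2 => AEC.subset_of_le (hXmono γ γ' hγ hγ').1 (h1 h2))
      fun x _ => by
        by_cases hx : ∃ i < (succ (succ lam)).ord, x ∈ (X i).1.carrier
        · obtain ⟨i, hi, hxi⟩ := hx
          exact ⟨i, hi, fun _ => hxi⟩
        · exact ⟨0, hθ.bot_lt, fun h1 => absurd h1 hx⟩) hθ.bot_lt
  obtain ⟨-, hlim, hcl⟩ := he 0 hθ.bot_lt
  have hi := helt 0 hθ.bot_lt
  set i := e 0
  have hi1 := add_one_lt_ord_succ hμ hi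
  have heq : (X i).1 = (X i).2 := by
    by_contra hne
    obtain ⟨a, ha2, ha1, ha⟩ := (hXstep i hi1).2 hne
    obtain ⟨β, hβ, haβ⟩ := (hXcont i hi hlim).2.1.subset ha2
    obtain ⟨γ, hγ, hQ⟩ := hcl β hβ
    exact ha (AEC.subset_of_le (hXmono γ i hγ.le hi).1 (hQ a haβ ⟨i + 1, hi1, ha1⟩))
  have hM'i : s.K.le M' (X i).1 := by
    have h1 := (hXmono 0 i hlim.bot_lt.le hi).2
    rw [hX0] at h1
    rwa [heq]
  have hlt : ∀ {j}, j < i + 1 → j < (succ (succ lam)).ord := fun hj => hj.trans hi1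
  have hres := leNF_of_chain hNF hlam hs.lst_le (N := fun j => (X j).1) (M' := M') hlim.bot_lt
    ⟨fun j k hjk hk => (hXmono j k hjk (hlt hk)).1, fun j hj hl => (hXcont j (hlt hj) hl).1⟩
    (fun j hj => (hXP j (hlt hj)).1)
    (fun j hj => (hXstep j (add_one_lt_ord_succ hμ (hj.trans hi))).1) hM'
    (by rw [hX0]; exact hle) hM'i
  simpa only [hX0] using hres
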